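/- Normalize the Fourier transform by $\hat f(\xi)=\int f(x)e^{-2\pi i x\cdot\xi}\,dx$, put $D_{x_l}=\frac1{2\pi i}\partial_{x_l}$, $\langle f,h\rangle=\int f\bar h$, and, for $z=(x,\xi)\in\mathbb R^{2d}$, $\pi(z)g(y)=e^{2\pi i \xi\cdot y}g(y-x)$. For $s,r>0$ the Gelfand–Shilov space $S^s_r(\mathbb R^d)$ consists of all Schwartz functions $f$ with $|x^\alpha\partial^\beta f(x)|\le K A^{|\alpha|}B^{|\beta|}(\alpha!)^r(\beta!)^s$ for all $x,\alpha,\beta$ and some $K,A,B>0$. For an operator $P(\partial_t,D_x)=\partial_t^m+\sum_{j=1}^m a_j(D_x)\partial_t^{m-j}$ with $m\ge1$ and polynomials $a_j$, the refined Hadamard–Petrowsky condition with exponent $\nu\ge 1$ is: there is $C>0$ such that $$(\tau,\zeta)\in\mathbb C\times\mathbb C^d,\quad P(i\tau,\zeta)=0\ \Longrightarrow\ \operatorname{Im}\tau\ge -C(1+|\operatorname{Im}\zeta|)^\nu .$$ Its propagator at time $t\ge0$ is the Fourier multiplier $\sigma(t,D_x)f=\mathcal F^{-1}(\sigma(t,\cdot)\hat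 f)$, where, for each $\xi$, $\sigma(\cdot,\xi)$ is the solution of $\big(\partial_t^m+\sum_{j=1}^m a_j(\xi)\partial_t^{m-j}\big)\sigma(t,\xi)=\delta(t)$ (in the sense of distributions) that vanishes for $t<0$ and is continuous on $[0,\infty)$. Let $k\ge1$ be an integer and let $P=\partial_t+(-\Delta)^k$ on $\mathbb R\times\mathbb R^d$. Then: 1. The symbol of $P$ is $P(i\tau,\zeta)=i\tau+(4\pi^2\zeta^2)^k$, where $\zeta^2=\zeta_1^2+\dots+\zeta_d^2$, i.e. $P$ acts on the exponentials $e^{st+2\pi i\zeta\cdot x}$ ($s\in\mathbb C$, $\zeta\in\mathbb C^d$) as multiplication by $P(s,\zeta)=s+(4\pi^2\zeta^2)^k$; and $P$ satisfies the refined Hadamard–Petrowsky condition with $\nu=2k$. 2. Put $r=\min\{2,\nu/(\nu-1)\}$ with $\nu=2k$; then $r=2k/(2k-1)$. The function $\sigma(t,\xi)$ above exists and is unique, and if $g\in S^{1/r}_{1/r}(\mathbb R^d)$, then for every bounded set $S\subset[0,\infty)$ there are $\epsilon>0$ and $C>0$ such that $$|\langle\sigma(t,D_x)\pi(z)g,\pi(w)g\rangle|\le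 C e^{-\epsilon|w-z|^{r}}\qquad\text{for all } t\in S,\ z,w\in\mathbb R^{2d}.$$ 3. In particular, for the heat operator $\partial_t-\Delta$ one has $\sigma(t,\xi)=e^{-4\pi^2t|\xi|^2}$ for $t\ge0$ (and $0$ for $t<0$), and if $g\in S^{1/2}_{1/2}(\mathbb R^d)$, then for every bounded set $S\subset[0,\infty)$ there are $\epsilon>0$ and $C>0$ such that $$|\langle e^{-4\pi^2t|D|^2}\pi(z)g,\pi(w)g\rangle|\le C e^{-\epsilon|w-z|^{2}}\qquad\text{for all } t\in S,\ z,w\in\mathbb R^{2d}.$$ -/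

import Mathlib

open MeasureTheory Real Set
open scoped FourierTransform SchwartzMap LineDeriv ContDiff Laplacian ComplexConjugate Nat

noncomputable section

namespace GaborParabolic

/-- The Euclidean space `ℝ^d`. -/
abbrev Space (d : ℕ) := EuclideanSpace ℝ (Fin d)

/-- The phase space `ℝ^{2d} = ℝ^d × ℝ^d` with its Euclidean norm. -/
abbrev PhaseSpace (d : ℕ) := WithLp 2 (Space d × Space d)

/-! ### Constant coefficient evolution operators and their symbols -/

/-- An operator `P(∂_t, D_x) = ∂_t^m + ∑_{j=1}^m a_j(D_x) ∂_t^{m-j}`, `D_{x_l} = (2πi)⁻¹ ∂_{x_l}`,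
with `m ≥ 1` and arbitrary polynomials `a_j`; `coeff j` is the polynomial `a_{j+1}`. -/
structure EvolutionOperator (d : ℕ) where
  /-- The order `m` in `∂_t`. -/
  order : ℕ
  order_pos : 0 < order
  /-- The polynomials `a_1, …, a_m`. -/
  coeff : Fin order → MvPolynomial (Fin d) ℂ

/-- The polynomial `P(s, ζ) = s^m + ∑_{j=1}^m a_j(ζ) s^{m-j}`, for complex `s` and `ζ`. -/
def EvolutionOperator.symbol {d : ℕ} (P : EvolutionOperator d) (s : ℂ)
    (ζ : EuclideanSpace ℂ (Fin d)) : ℂ :=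
  s ^ P.order +
    ∑ j : Fin P.order, MvPolynomial.eval (fun l => ζ l) (P.coeff j) * s ^ (P.order - (j.val + 1))

/-- The vector `Im ζ ∈ ℝ^d` of a vector `ζ ∈ ℂ^d`. -/
def imPart {d : ℕ} (ζ : EuclideanSpace ℂ (Fin d)) : Space d :=
  WithLp.toLp 2 fun l => (ζ l).im

/-- The refined Hadamard–Petrowsky condition with exponent `ν ≥ 1`. -/
def RefinedHadamardPetrowsky {d : ℕ} (P : EvolutionOperator d) (ν : ℝ) : Prop :=
  1 ≤ ν ∧ ∃ C : ℝ, 0 < C ∧ ∀ (τ : ℂ) (ζ : EuclideanSpace ℂ (Fin d)),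
    P.symbol (Complex.I * τ) ζ = 0 → τ.im ≥ -C * (1 + ‖imPart ζ‖) ^ ν

/-- `σ(t, ξ)` is, for every frequency `ξ`, a solution of
`(∂_t^m + ∑_{j=1}^m a_j(ξ) ∂_t^{m-j}) σ(t, ξ) = δ(t)` in the sense of distributions on `ℝ`,
supported in `[0, ∞)`. The condition `continuousOn` selects the representative that is continuous
on `[0, ∞)`, so that the value of `σ` at each time `t ≥ 0` makes sense. -/
structure IsFundamentalSymbol {d : ℕ} (P : EvolutionOperator d) (σ : ℝ → Space d → ℂ) : Prop where
  support : ∀ t < 0, ∀ ξ, σ t ξ = 0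
  continuousOn : ∀ ξ, ContinuousOn (fun t => σ t ξ) (Ici 0)
  equation : ∀ (ξ : Space d) (η : ℝ → ℂ), ContDiff ℝ ∞ η → HasCompactSupport η →
    ∫ t : ℝ, σ t ξ * ((-1) ^ P.order * iteratedDeriv P.order η t +
      ∑ j : Fin P.order, MvPolynomial.eval (fun l => (ξ l : ℂ)) (P.coeff j) *
        ((-1) ^ (P.order - (j.val + 1)) * iteratedDeriv (P.order - (j.val + 1)) η t)) = η 0

/-! ### The operator `∂_t + (-Δ)^k` -/

/-- The action `u ↦ ∂_t u + (-Δ)^k u` on functions `u(t, x)`. -/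
def parabolicAction (d k : ℕ) (u : ℝ → Space d → ℂ) (t : ℝ) (x : Space d) : ℂ :=
  deriv (fun s => u s x) t + ((fun f : Space d → ℂ => -(Δ f))^[k] (u t)) x

/-- `∂_t + (-Δ)^k` in the form `∂_t + a_1(D_x)`, with `a_1(ζ) = (4π² (ζ_1² + ⋯ + ζ_d²))^k`. -/
def parabolic (d k : ℕ) : EvolutionOperator d where
  order := 1
  order_pos := one_pos
  coeff _ := (MvPolynomial.C (4 * (π : ℂ) ^ 2) * ∑ l : Fin d, MvPolynomial.X l ^ 2) ^ k

/-- The exponential `e^{st + 2πi ζ·x}`, for `s ∈ ℂ` and `ζ ∈ ℂ^d`. -/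
def expWave {d : ℕ} (s : ℂ) (ζ : EuclideanSpace ℂ (Fin d)) (t : ℝ) (x : Space d) : ℂ :=
  Complex.exp (s * t + 2 * π * Complex.I * ∑ l : Fin d, ζ l * (x l : ℂ))

/-- The function `e^{-4π² t |ξ|²}` for `t ≥ 0`, and `0` for `t < 0`. -/
def heatSymbol (d : ℕ) (t : ℝ) (ξ : Space d) : ℂ :=
  if 0 ≤ t then (Real.exp (-4 * π ^ 2 * t * ‖ξ‖ ^ 2) : ℂ) else 0

/-! ### Gelfand–Shilov spaces -/

/-- The partial derivative `∂^β f = ∂_1^{β_1} ⋯ ∂_d^{β_d} f` of a Schwartz function. -/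
def multiDeriv {d : ℕ} (β : Fin d → ℕ) (f : 𝓢(Space d, ℂ)) : 𝓢(Space d, ℂ) :=
  (List.finRange d).foldr
    (fun l h => (fun v : 𝓢(Space d, ℂ) => ∂_{(EuclideanSpace.single l (1 : ℝ) : Space d)} v)^[β l] h)
    f

/-- The Gelfand–Shilov space `S^s_r(ℝ^d)`: the Schwartz functions `f` such that
`|x^α ∂^β f(x)| ≤ K A^{|α|} B^{|β|} (α!)^r (β!)^s` for some `K, A, B > 0`. -/
def gelfandShilov (d : ℕ) (s r : ℝ) : Set 𝓢(Space d, ℂ) :=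
  {f | ∃ K > 0, ∃ A > 0, ∃ B > 0, ∀ (α β : Fin d → ℕ) (x : Space d),
    ‖((∏ l, x l ^ α l : ℝ) : ℂ) * multiDeriv β f x‖ ≤
      K * A ^ (∑ l, α l) * B ^ (∑ l, β l) *
        ((∏ l, (α l)! : ℕ) : ℝ) ^ r * ((∏ l, (β l)! : ℕ) : ℝ) ^ s}

/-! ### Time-frequency shifts, Fourier multipliers and the Gabor matrix -/

/-- The time-frequency shift `π(z) g (y) = e^{2πi ξ·y} g(y - x)`, `z = (x, ξ)`. -/
def tfShift {d : ℕ} (z : PhaseSpace d) (g : Space d → ℂ) (y : Space d) : ℂ :=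
  Complex.exp (2 * π * Complex.I * (inner ℝ z.snd y : ℝ)) * g (y - z.fst)

/-- The Fourier multiplier `σ(D) f = 𝓕⁻¹ (σ 𝓕 f)`. -/
def multiplier {d : ℕ} (σ : Space d → ℂ) (f : Space d → ℂ) : Space d → ℂ :=
  𝓕⁻ (fun ξ => σ ξ * 𝓕 f ξ)

/-- The entry `⟨σ(D) π(z) g, π(w) g⟩` of the Gabor matrix, with `⟨f, h⟩ = ∫ f(y) conj (h(y)) dy`. -/
def gaborMatrix {d : ℕ} (σ : Space d → ℂ) (g : Space d → ℂ) (z w : PhaseSpace d) : ℂ :=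
  ∫ y : Space d, multiplier σ (tfShift z g) y * conj (tfShift w g y)

end GaborParabolic

end

open GaborParabolic

/-! Everything rests on one inequality, `exists_le_re_pow`: for `ζ = ξ + iη` one has `Re (ζ²)^k ≥
|ξ|^{2k}/2 - C |η|^{2k}`. At a zero of the symbol, `Im τ = Re (4π²ζ²)^k`, so the inequality is the
refined Hadamard-Petrowsky condition with `ν = 2k`. It also governs the kernel `K = 𝓕⁻¹
e^{-(4π²|ξ|²)^k}`: shifting the frequency integral by `ib y/|y|` gains `e^{-2πb|y|}` and loses at
most `e^{C b^{2k}}`. Taking `b` a small multiple of `|y|^{1/(2k-1)}` makes both exponents multiples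
of `|y|^r`, `r = 2k/(2k-1)`, whence `exists_parabolicKernel_decay`.

The Gabor matrix is estimated twice. On the Fourier side only `|σ| ≤ 1` and the decay of `𝓕 g` are
used, giving decay in the frequency separation (`norm_gaborMatrix_le_frequency`). On the space side
the propagator averages the translates `f(y - t^{1/(2k)} v)` against `K(v) dv`, giving decay in the
spatial separation, uniformly for bounded `t` (`norm_gaborMatrix_le_space`). The larger separation
is comparable to `|w - z|`.

The decay `e^{-ε|x|^r}` of `g` and `𝓕 g` comes from optimizing the factorial moment bounds over
their order. The symbol `σ` is identified by testing the distributional equation against solutions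
of the adjoint equation. -/

namespace GaborParabolic

/-! ### Lower bounds for the real part of powers -/

/-- If `z` is at distance at most `2ab + b²` from `a²`, then `Re z^k` is bounded below by
`a^{2k} / 2` up to a multiple of `b^{2k}`. -/
theorem exists_le_re_pow (k : ℕ) : ∃ C : ℝ, 0 < C ∧ ∀ (a b : ℝ) (z : ℂ), 0 ≤ a → 0 ≤ b →
    ‖z - (a : ℂ) ^ 2‖ ≤ 2 * a * b + b ^ 2 →
    a ^ (2 * k) / 2 - C * b ^ (2 * k) ≤ (z ^ k).re := by
  have hcont : Continuous fun w : ℂ => ((1 + w) ^ k).re := by fun_prop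
  have hev : ∀ᶠ w : ℂ in nhds 0, (1 / 2 : ℝ) < ((1 + w) ^ k).re :=
    hcont.continuousAt.eventually_const_lt (by norm_num)
  obtain ⟨δ, hδ, hball⟩ := Metric.eventually_nhds_iff.1 hev
  -- Threshold between two regimes. If `b ≤ ρ a`, the relative deviation of `z` from `a²` is at most
  -- `2ρ + ρ² ≤ 3ρ < δ`, so `Re z^k > a^{2k}/2`. Otherwise `a` and `|z|^{1/2}` are `O(b)`, and the
  -- two summands of the constant absorb `a^{2k}/2` and `|z|^k`.
  set ρ : ℝ := min 1 (δ / 4) with hρ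
  have hρ0 : 0 < ρ := by positivity
  have hρ1 : ρ ≤ 1 := min_le_left _ _
  have hρδ : ρ ≤ δ / 4 := min_le_right _ _
  refine ⟨(1 / ρ) ^ (2 * k) / 2 + ((1 / ρ + 1) ^ 2) ^ k, by positivity, fun a b z ha hb hz => ?_⟩
  by_cases h : b ≤ ρ * a
  · rcases ha.eq_or_lt with rfl | ha'
    · obtain rfl : b = 0 := le_antisymm (by simpa using h) hb
      have hz0 : z = 0 := by simpa using hz
      subst hz0
      rcases k.eq_zero_or_pos with rfl | hk
      · norm_num
      · simp [hk.ne']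
    have hac : (a : ℂ) ≠ 0 := by exact_mod_cast ha'.ne'
    have hlt : ‖(z - (a : ℂ) ^ 2) / (a : ℂ) ^ 2‖ < δ := by
      rw [norm_div, norm_pow, Complex.norm_real, Real.norm_of_nonneg ha, div_lt_iff₀ (by positivity)]
      have h1 : b ^ 2 ≤ ρ * a ^ 2 := by
        nlinarith [mul_le_mul_of_nonneg_right h hb, mul_le_mul_of_nonneg_left h ha,
          mul_le_mul_of_nonneg_right hρ1 (mul_nonneg ha hb)]
      have h2 : a * b ≤ ρ * a ^ 2 := by nlinarith
      have h3 : 0 < a ^ 2 := by positivity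
      nlinarith
    have hre := hball (by rwa [dist_zero_right])
    have hzk : z ^ k = ((a ^ (2 * k) : ℝ) : ℂ) * (1 + (z - (a : ℂ) ^ 2) / (a : ℂ) ^ 2) ^ k := by
      push_cast
      rw [pow_mul, ← mul_pow]
      congr 1
      field_simp
      ring
    rw [hzk, Complex.re_ofReal_mul]
    have h4 : 0 ≤ a ^ (2 * k) := by positivity
    have h5 : 0 ≤ ((1 / ρ) ^ (2 * k) / 2 + ((1 / ρ + 1) ^ 2) ^ k) * b ^ (2 * k) := by positivity
    nlinarith
  · push Not at h
    have hab : a ≤ 1 / ρ * b := by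
      rw [one_div, inv_mul_eq_div, le_div_iff₀ hρ0]; linarith
    have hnz : ‖z‖ ≤ (1 / ρ + 1) ^ 2 * b ^ 2 := by
      have h1 := norm_add_le (z - (a : ℂ) ^ 2) ((a : ℂ) ^ 2)
      rw [sub_add_cancel] at h1
      rw [norm_pow, Complex.norm_real, Real.norm_of_nonneg ha] at h1
      calc ‖z‖ ≤ (a + b) ^ 2 := by linarith
        _ ≤ ((1 / ρ + 1) * b) ^ 2 := by gcongr; linarith
        _ = _ := by ring
    have h1 : ‖z ^ k‖ ≤ ((1 / ρ + 1) ^ 2) ^ k * b ^ (2 * k) := by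
      rw [norm_pow, pow_mul, ← mul_pow]
      gcongr
    have h2 : a ^ (2 * k) ≤ (1 / ρ) ^ (2 * k) * b ^ (2 * k) := by
      rw [← mul_pow]
      gcongr
    have h3 := (abs_le.1 (Complex.abs_re_le_norm (z ^ k))).1
    linarith

/-! ### Stretched exponential decay -/

/-- Factorial growth of the moments amounts to stretched exponential decay. -/
theorem exists_exp_decay_of_moments {K A r : ℝ} (hK : 0 < K) (hA : 0 < A) (hr : 0 < r) :
    ∃ ε > 0, ∃ C > 0, ∀ ρ a : ℝ, 0 ≤ ρ →
      (∀ N : ℕ, ρ ^ N * a ≤ K * A ^ N * (N ! : ℝ) ^ (1 / r)) →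
      a ≤ C * Real.exp (-ε * ρ ^ r) := by
  refine ⟨(1 / (Real.exp 1 * A)) ^ r, by positivity, K * Real.exp 1, by positivity,
    fun ρ a hρ h => ?_⟩
  rcases hρ.eq_or_lt with rfl | hρ'
  · have h0 := h 0
    simp only [pow_zero, one_mul, mul_one, Nat.factorial_zero, Nat.cast_one, Real.one_rpow] at h0
    rw [Real.zero_rpow hr.ne', mul_zero, Real.exp_zero, mul_one]
    exact h0.trans (le_mul_of_one_le_right hK.le (Real.one_le_exp zero_le_one))
  set X : ℝ := (1 / (Real.exp 1 * A)) ^ r * ρ ^ r with hX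
  have hX0 : 0 ≤ X := by positivity
  have hXr : X = (ρ / (Real.exp 1 * A)) ^ r := by
    rw [hX, ← Real.mul_rpow (by positivity) hρ, one_div_mul_eq_div]
  -- A near-optimal moment order: `N ≤ X = (ρ/(eA))^r` gives `A N^{1/r} ≤ ρ/e`, so with `N! ≤ N^N`
  -- the `N`-th bound yields `a ≤ K e^{-N}`. Rounding down costs the factor `e` in the constant.
  set N : ℕ := ⌊X⌋₊ with hN
  have hNX : (N : ℝ) ≤ X := Nat.floor_le hX0
  have hXN : X < N + 1 := Nat.lt_floor_add_one X
  have hroot : A * (N : ℝ) ^ (1 / r) ≤ ρ * Real.exp (-1) := by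
    have h1 : (N : ℝ) ^ (1 / r) ≤ ρ / (Real.exp 1 * A) := by
      calc (N : ℝ) ^ (1 / r) ≤ X ^ (1 / r) := by gcongr
        _ = _ := by
          rw [hXr, ← Real.rpow_mul (by positivity), mul_one_div_cancel hr.ne', Real.rpow_one]
    calc A * (N : ℝ) ^ (1 / r) ≤ A * (ρ / (Real.exp 1 * A)) := by gcongr
      _ = _ := by rw [Real.exp_neg]; field_simp
  have hfac : A ^ N * (N ! : ℝ) ^ (1 / r) ≤ (ρ * Real.exp (-1)) ^ N := by
    have h1 : (N ! : ℝ) ^ (1 / r) ≤ ((N : ℝ) ^ (1 / r)) ^ N := by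
      rw [← Real.rpow_natCast, ← Real.rpow_mul (by positivity), mul_comm (1 / r),
        Real.rpow_mul (by positivity), Real.rpow_natCast]
      gcongr
      exact_mod_cast Nat.factorial_le_pow N
    calc A ^ N * (N ! : ℝ) ^ (1 / r) ≤ A ^ N * ((N : ℝ) ^ (1 / r)) ^ N := by gcongr
      _ = (A * (N : ℝ) ^ (1 / r)) ^ N := (mul_pow _ _ _).symm
      _ ≤ _ := by gcongr
  have h1 : ρ ^ N * a ≤ ρ ^ N * (K * Real.exp (-1) ^ N) := by
    calc ρ ^ N * a ≤ K * (A ^ N * (N ! : ℝ) ^ (1 / r)) := by rw [← mul_assoc]; exact h N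
      _ ≤ K * (ρ * Real.exp (-1)) ^ N := by gcongr
      _ = _ := by rw [mul_pow]; ring
  have h2 : a ≤ K * Real.exp (-1) ^ N := le_of_mul_le_mul_left h1 (by positivity)
  refine h2.trans ?_
  rw [← Real.exp_nat_mul, mul_assoc, ← Real.exp_add]
  gcongr
  rw [neg_mul, ← hX]
  linarith

theorem le_one_add_rpow {r x : ℝ} (hr : 1 ≤ r) (hx : 0 ≤ x) : x ≤ 1 + x ^ r := by
  rcases le_total x 1 with h | h
  · linarith [Real.rpow_nonneg hx r]
  · linarith [Real.self_le_rpow_of_one_le h hr]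

theorem norm_add_rpow_le {V : Type*} [SeminormedAddCommGroup V] {r : ℝ} (hr : 0 ≤ r) (a b : V) :
    ‖a + b‖ ^ r ≤ 2 ^ r * (‖a‖ ^ r + ‖b‖ ^ r) := by
  have h1 : ‖a + b‖ ≤ 2 * max ‖a‖ ‖b‖ := by
    linarith [norm_add_le a b, le_max_left ‖a‖ ‖b‖, le_max_right ‖a‖ ‖b‖]
  have h2 : (max ‖a‖ ‖b‖) ^ r ≤ ‖a‖ ^ r + ‖b‖ ^ r := by
    have ha : 0 ≤ ‖a‖ ^ r := by positivity
    have hb : 0 ≤ ‖b‖ ^ r := by positivity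
    rcases max_choice ‖a‖ ‖b‖ with h | h <;> rw [h] <;> linarith
  calc ‖a + b‖ ^ r ≤ (2 * max ‖a‖ ‖b‖) ^ r := by gcongr
    _ = 2 ^ r * (max ‖a‖ ‖b‖) ^ r := Real.mul_rpow (by norm_num) (by positivity)
    _ ≤ _ := by gcongr

section Integrability

variable {V : Type*} [NormedAddCommGroup V] [NormedSpace ℝ V] [FiniteDimensional ℝ V]
  [MeasurableSpace V] [BorelSpace V] (μ : Measure V) [μ.IsAddHaarMeasure]

/-- Since `r ≥ 1`, `1 + ‖x‖ ≤ 2 + ‖x‖^r`. This reduces to an ordinary exponential, which is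
dominated by the integrable weight `(1 + ‖x‖)^{-(dim V + 1)}`. -/
theorem integrable_exp_neg_mul_norm_rpow {ε r : ℝ} (hε : 0 < ε) (hr : 1 ≤ r) :
    Integrable (fun x : V => Real.exp (-ε * ‖x‖ ^ r)) μ := by
  set N : ℕ := Module.finrank ℝ V + 1 with hN
  have hint : Integrable (fun x : V => (1 + ‖x‖) ^ (-(N : ℝ))) μ :=
    integrable_one_add_norm (by rw [hN]; push_cast; linarith)
  have hr0 : 0 ≤ r := zero_le_one.trans hr
  have hc : Continuous fun x : V => Real.exp (-ε * ‖x‖ ^ r) := by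
    have : Continuous fun x : V => ‖x‖ ^ r := continuous_norm.rpow_const fun _ => Or.inr hr0
    fun_prop
  refine (hint.const_mul (Real.exp (2 * ε) * ((N ! : ℝ) / ε ^ N))).mono' hc.aestronglyMeasurable
    (.of_forall fun x => ?_)
  rw [Real.norm_of_nonneg (Real.exp_pos _).le, Real.rpow_neg (by positivity), Real.rpow_natCast]
  have h1 := le_one_add_rpow hr (norm_nonneg x)
  have h2 := Real.pow_div_factorial_le_exp (ε * (1 + ‖x‖)) (by positivity) N
  have h3 : Real.exp (-ε * ‖x‖ ^ r) ≤ Real.exp (2 * ε) * Real.exp (-(ε * (1 + ‖x‖))) := by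
    rw [← Real.exp_add]
    gcongr
    nlinarith
  refine h3.trans ?_
  rw [mul_assoc]
  gcongr
  rw [Real.exp_neg, ← inv_inv ((N ! : ℝ) / ε ^ N), ← mul_inv]
  apply inv_anti₀ (by positivity)
  rw [mul_pow] at h2
  rw [inv_div]
  calc _ = _ := by ring
    _ ≤ _ := h2

end Integrability

/-! ### The first order equation `f' + a f = δ` -/

/-- `e^{-at}` on the positive half line is a fundamental solution of `∂_t + a`. -/
theorem integral_exp_fundamental (a : ℂ) {η : ℝ → ℂ} (hη : ContDiff ℝ ∞ η)
    (hs : HasCompactSupport η) :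
    ∫ t : ℝ, (if 0 ≤ t then Complex.exp (-(a * t)) else 0) * (-deriv η t + a * η t) = η 0 := by
  -- On the half line the integrand is minus the derivative of the compactly supported function
  -- `e^{-at} η`, so only the boundary value at `0` survives.
  have hd : ∀ t : ℝ, HasDerivAt (fun t : ℝ => Complex.exp (-(a * t)) * η t)
      (-(Complex.exp (-(a * (t : ℂ))) * (-deriv η t + a * η t))) t := by
    intro t
    have h1 : HasDerivAt (fun t : ℝ => Complex.exp (-(a * t)))
        (Complex.exp (-(a * (t : ℂ))) * -(a * 1)) t := by
      have h0 : HasDerivAt (fun t : ℝ => (t : ℂ)) 1 t := Complex.ofRealCLM.hasDerivAt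
      exact ((h0.const_mul a).neg).cexp
    have h2 : HasDerivAt η (deriv η t) t := (hη.differentiable (by simp) t).hasDerivAt
    refine (h1.mul h2).congr_deriv ?_
    ring
  have hcs : HasCompactSupport (fun t : ℝ => Complex.exp (-(a * t)) * η t) := hs.mul_left
  have hd' : Continuous (deriv η) := hη.continuous_deriv (by simp)
  have hcs' : HasCompactSupport fun t : ℝ => -(Complex.exp (-(a * t)) * (-deriv η t + a * η t)) :=
    HasCompactSupport.intro hs fun t ht => by
      have h1 : deriv η t = 0 := by
        by_contra h
        exact ht (support_deriv_subset h)
      simp [image_eq_zero_of_notMem_tsupport ht, h1]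
  have hc' : Continuous fun t : ℝ => -(Complex.exp (-(a * t)) * (-deriv η t + a * η t)) := by
    have := hη.continuous
    fun_prop
  have hftc := integral_Ioi_of_hasDerivAt_of_tendsto' (a := 0) (fun t _ => hd t)
    (hc'.integrable_of_hasCompactSupport hcs').integrableOn
    ((hcs.is_zero_at_infty).mono_left atTop_le_cocompact)
  have heq : (fun t : ℝ => (if 0 ≤ t then Complex.exp (-(a * t)) else 0) *
      (-deriv η t + a * η t)) =
      (Ici 0).indicator fun t : ℝ => Complex.exp (-(a * t)) * (-deriv η t + a * η t) := by
    ext t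
    by_cases ht : 0 ≤ t <;> simp [ht]
  rw [heq, integral_indicator measurableSet_Ici, integral_Ici_eq_integral_Ioi]
  rw [integral_neg] at hftc
  simpa using hftc

/-- The fundamental solution of `∂_t + a` supported in `[0, ∞)` is unique. -/
theorem eq_exp_of_fundamental (a : ℂ) {f : ℝ → ℂ} (hneg : ∀ t < 0, f t = 0)
    (hf : ContinuousOn f (Ici 0))
    (heq : ∀ η : ℝ → ℂ, ContDiff ℝ ∞ η → HasCompactSupport η →
      ∫ t : ℝ, f t * (-deriv η t + a * η t) = η 0) {t : ℝ} (ht : 0 ≤ t) :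
    f t = Complex.exp (-(a * t)) := by
  -- The claim becomes `G = 1` on `[0, ∞)`. It is first proved almost everywhere, by comparing `G`
  -- with the Heaviside function against every test function `ψ`.
  set G : ℝ → ℂ := fun t => f t * Complex.exp (a * t) with hG
  set H : ℝ → ℂ := (Ici 0).indicator fun _ => 1 with hH
  have hGc : ContinuousOn G (Ici 0) := hf.mul (by fun_prop)
  have hGi : G = (Ici 0).indicator G := by
    ext t
    by_cases h : 0 ≤ t
    · simp [h]
    · simp [h, hG, hneg t (not_le.1 h)]
  have hGl : LocallyIntegrable G := by
    rw [hGi]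
    refine fun x => ?_
    obtain ⟨K, hK, hxK⟩ := exists_compact_mem_nhds x
    refine ⟨K, hxK, ?_⟩
    rw [IntegrableOn, integrable_indicator_iff measurableSet_Ici, IntegrableOn,
      Measure.restrict_restrict measurableSet_Ici]
    exact (hGc.mono inter_subset_left).integrableOn_compact
      (hK.inter_left isClosed_Ici)
  have hHl : LocallyIntegrable H :=
    (locallyIntegrable_const 1).indicator measurableSet_Ici
  have hae : ∀ᵐ t, G t = H t := by
    refine ae_eq_of_integral_contDiff_smul_eq hGl hHl fun ψ hψ hψs => ?_
    obtain ⟨M, hM0, hM⟩ : ∃ M : ℝ, 0 < M ∧ ∀ t, M ≤ t → ψ t = 0 := by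
      obtain ⟨R, hR, hRs⟩ := hψs.exists_pos_le_norm
      exact ⟨R, hR, fun t ht => hRs t (ht.trans (le_abs_self t))⟩
    -- As `Ψ' = -ψ` and `Ψ` vanishes beyond `M`, the function `e^{at} Ψ` solves the adjoint equation
    -- `-η' + aη = e^{at} ψ`, with value `∫_0^∞ ψ` at `0`.
    set Ψ : ℝ → ℝ := fun t => ∫ s in t..M, ψ s with hΨ
    have hΨd : ∀ t, HasDerivAt Ψ (-ψ t) t := fun t =>
      intervalIntegral.integral_hasDerivAt_left (hψ.continuous.intervalIntegrable _ _)
        (hψ.continuous.stronglyMeasurableAtFilter _ _) hψ.continuous.continuousAt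
    have hΨs : ContDiff ℝ ∞ Ψ := by
      rw [contDiff_infty_iff_deriv]
      refine ⟨fun t => (hΨd t).differentiableAt, ?_⟩
      rw [show deriv Ψ = fun t => -ψ t from funext fun t => (hΨd t).deriv]
      exact hψ.neg
    -- `Ψ` need not vanish for very negative `t`. The cutoff is `0` on `(-∞, -2]` and `1` on `[-1,
    -- ∞)`, so it gives compact support without changing anything near `[0, ∞)`.
    set χ : ℝ → ℝ := fun t => Real.smoothTransition (t + 2) with hχ
    have hχs : ContDiff ℝ ∞ χ := Real.smoothTransition.contDiff.comp (by fun_prop)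
    set η : ℝ → ℂ := fun t => Complex.exp (a * t) * ((χ t * Ψ t : ℝ) : ℂ) with hη
    have hofR : ContDiff ℝ ∞ (fun t : ℝ => (t : ℂ)) := Complex.ofRealCLM.contDiff
    have hηs : ContDiff ℝ ∞ η :=
      (ContDiff.cexp (contDiff_const.mul hofR)).mul (hofR.comp (hχs.mul hΨs))
    have hηc : HasCompactSupport η := by
      refine HasCompactSupport.intro (isCompact_Icc (a := -2) (b := M)) fun t ht => ?_
      rw [mem_Icc, not_and_or, not_le, not_le] at ht
      rcases ht with h | h
      · simp [hη, hχ, Real.smoothTransition.zero_of_nonpos (show t + 2 ≤ 0 by linarith)]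
      · have : Ψ t = 0 := by
          rw [hΨ]
          simp only
          rw [intervalIntegral.integral_symm, neg_eq_zero]
          refine intervalIntegral.integral_zero_ae (.of_forall fun s hs => hM s ?_)
          rw [uIoc_of_le h.le] at hs
          exact hs.1.le
        simp [hη, this]
    have hχ1 : ∀ t : ℝ, -1 ≤ t → χ t = 1 := fun t ht =>
      Real.smoothTransition.one_of_one_le (by linarith)
    have hηd : ∀ t : ℝ, 0 ≤ t → -deriv η t + a * η t = Complex.exp (a * t) * ψ t := by
      intro t ht
      have h1 : HasDerivAt (fun t : ℝ => Complex.exp (a * t))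
          (Complex.exp (a * t) * (a * 1)) t := by
        have h0 : HasDerivAt (fun t : ℝ => (t : ℂ)) 1 t := Complex.ofRealCLM.hasDerivAt
        exact (h0.const_mul a).cexp
      have h2 : HasDerivAt η (Complex.exp (a * t) * (a * 1) * (Ψ t : ℂ) +
          Complex.exp (a * t) * ((-ψ t : ℝ) : ℂ)) t := by
        refine (h1.mul (hΨd t).ofReal_comp).congr_of_eventuallyEq ?_
        filter_upwards [Ioi_mem_nhds (show (-1 : ℝ) < t by linarith)] with s hs
        simp [hη, hχ1 s (le_of_lt hs)]
      rw [h2.deriv, hη]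
      simp only [hχ1 t (by linarith)]
      push_cast
      ring
    have key := heq η hηs hηc
    have h3 : (fun t : ℝ => f t * (-deriv η t + a * η t)) = fun t => ψ t • G t := by
      ext t
      by_cases h : 0 ≤ t
      · rw [hηd t h, hG, Complex.real_smul]; ring
      · simp [hG, hneg t (not_le.1 h)]
    have h4 : η 0 = ∫ t, ψ t • H t := by
      have h5 : (fun t => ψ t • H t) = (Ici 0).indicator fun t => (ψ t : ℂ) := by
        ext t
        by_cases h : 0 ≤ t <;> simp [hH, h]
      rw [h5, integral_indicator measurableSet_Ici, integral_Ici_eq_integral_Ioi,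
        integral_complex_ofReal]
      simp only [hη, hχ1 0 (by norm_num), hΨ, Complex.ofReal_zero, mul_zero, Complex.exp_zero,
        one_mul]
      congr 1
      rw [intervalIntegral.integral_of_le hM0.le]
      refine (setIntegral_eq_of_subset_of_forall_sdiff_eq_zero measurableSet_Ioi
        Ioc_subset_Ioi_self fun s hs => hM s ?_).symm
      by_contra h
      exact hs.2 ⟨hs.1, (not_le.1 h).le⟩
    rw [← h3, key, h4]
  have hcont1 : ContinuousOn (fun _ : ℝ => (1 : ℂ)) (Ici 0) := continuousOn_const
  -- Almost everywhere equality becomes equality everywhere on `[0, ∞)`, endpoint included, by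
  -- continuity there and because the half line is the closure of its interior.
  have hG1 : EqOn G (fun _ => 1) (Ici 0) := by
    refine Measure.eqOn_of_ae_eq (μ := volume) ?_ hGc hcont1 ?_
    · rw [Filter.EventuallyEq, ae_restrict_iff' measurableSet_Ici]
      filter_upwards [hae] with t ht hmem
      rw [ht, hH, indicator_of_mem hmem]
    · rw [interior_Ici, closure_Ioi]
  have h1 : f t * Complex.exp (a * t) = 1 := hG1 ht
  rw [Complex.exp_neg]
  exact eq_inv_of_mul_eq_one_left h1

/-! ### The fundamental symbol of the parabolic operator -/

/-- The values `(4π² ‖ξ‖²)^k` of the symbol of `(-Δ)^k` at real frequencies. -/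
noncomputable def parabolicRate (d k : ℕ) (ξ : Space d) : ℝ := (4 * π ^ 2 * ‖ξ‖ ^ 2) ^ k

theorem eval_parabolic_coeff {d k : ℕ} (ζ : Fin d → ℂ) (j : Fin (parabolic d k).order) :
    MvPolynomial.eval ζ ((parabolic d k).coeff j) = (4 * (π : ℂ) ^ 2 * ∑ l, ζ l ^ 2) ^ k := by
  simp [parabolic]

theorem eval_parabolic_coeff_real {d k : ℕ} (ξ : Space d) (j : Fin (parabolic d k).order) :
    MvPolynomial.eval (fun l => (ξ l : ℂ)) ((parabolic d k).coeff j) = parabolicRate d k ξ := by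
  rw [eval_parabolic_coeff, parabolicRate, EuclideanSpace.norm_sq_eq]
  simp

theorem sum_fin_parabolic_order {d k : ℕ} (f : Fin (parabolic d k).order → ℂ) :
    ∑ j, f j = f ⟨0, one_pos⟩ :=
  Fin.sum_univ_one f

theorem parabolic_symbol {d k : ℕ} (s : ℂ) (ζ : EuclideanSpace ℂ (Fin d)) :
    (parabolic d k).symbol s ζ = s + (4 * (π : ℂ) ^ 2 * ∑ l, ζ l ^ 2) ^ k := by
  simp only [EvolutionOperator.symbol, eval_parabolic_coeff, sum_fin_parabolic_order]
  simp [parabolic]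

theorem parabolic_adjoint {d k : ℕ} (ξ : Space d) (η : ℝ → ℂ) (t : ℝ) :
    ((-1) ^ (parabolic d k).order * iteratedDeriv (parabolic d k).order η t +
      ∑ j : Fin (parabolic d k).order,
        MvPolynomial.eval (fun l => (ξ l : ℂ)) ((parabolic d k).coeff j) *
        ((-1) ^ ((parabolic d k).order - (j.val + 1)) *
          iteratedDeriv ((parabolic d k).order - (j.val + 1)) η t)) =
      -deriv η t + parabolicRate d k ξ * η t := by
  simp only [eval_parabolic_coeff_real, sum_fin_parabolic_order]
  simp [parabolic]

/-- The function `e^{-t (4π² ‖ξ‖²)^k}` for `t ≥ 0`, and `0` for `t < 0`. -/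
noncomputable def parabolicSymbol (d k : ℕ) (t : ℝ) (ξ : Space d) : ℂ :=
  if 0 ≤ t then Complex.exp (-(parabolicRate d k ξ * t)) else 0

theorem isFundamentalSymbol_parabolicSymbol (d k : ℕ) :
    IsFundamentalSymbol (parabolic d k) (parabolicSymbol d k) where
  support t ht ξ := by simp [parabolicSymbol, not_le.2 ht]
  continuousOn ξ := by
    refine ContinuousOn.congr (f := fun t : ℝ => Complex.exp (-(parabolicRate d k ξ * t)))
      (by fun_prop) fun t ht => ?_
    simp only [parabolicSymbol, if_pos (mem_Ici.1 ht)]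
  equation ξ η hη hs := by
    simp only [parabolic_adjoint]
    exact integral_exp_fundamental _ hη hs

theorem IsFundamentalSymbol.eq_parabolicSymbol {d k : ℕ} {σ : ℝ → Space d → ℂ}
    (h : IsFundamentalSymbol (parabolic d k) σ) : σ = parabolicSymbol d k := by
  ext t ξ
  rcases lt_or_ge t 0 with ht | ht
  · rw [h.support t ht, parabolicSymbol, if_neg (not_le.2 ht)]
  · rw [parabolicSymbol, if_pos ht]
    refine eq_exp_of_fundamental _ (fun t ht => h.support t ht ξ) (h.continuousOn ξ)
      (fun η hη hs => ?_) ht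
    have := h.equation ξ η hη hs
    simp only [parabolic_adjoint] at this
    exact this

theorem heatSymbol_eq (d : ℕ) : heatSymbol d = parabolicSymbol d 1 := by
  ext t ξ
  rw [heatSymbol, parabolicSymbol]
  congr 1
  rw [Complex.ofReal_exp, parabolicRate]
  push_cast
  ring_nf

/-! ### The refined Hadamard-Petrowsky condition -/

/-- With `ζ = ξ + iη` and `a = |ξ|`, `ζ² - a² = 2i ξ·η - |η|²`, so Cauchy-Schwarz applies. This is
the hypothesis of `exists_le_re_pow` with `b = |η|`. -/
theorem norm_sum_sq_sub_le {d : ℕ} (ζ : EuclideanSpace ℂ (Fin d)) :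
    ∃ a : ℝ, 0 ≤ a ∧
      ‖∑ l, ζ l ^ 2 - (a : ℂ) ^ 2‖ ≤ 2 * a * ‖imPart ζ‖ + ‖imPart ζ‖ ^ 2 := by
  set ξ : Space d := WithLp.toLp 2 fun l => (ζ l).re with hξ
  refine ⟨‖ξ‖, norm_nonneg _, ?_⟩
  have h1 : ∑ l, ζ l ^ 2 - (‖ξ‖ : ℂ) ^ 2 =
      ((2 * inner ℝ ξ (imPart ζ) : ℝ) : ℂ) * Complex.I - ((‖imPart ζ‖ ^ 2 : ℝ) : ℂ) := by
    have h2 : (‖ξ‖ : ℂ) ^ 2 = ((‖ξ‖ ^ 2 : ℝ) : ℂ) := by push_cast; rfl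
    rw [h2, EuclideanSpace.norm_sq_eq, EuclideanSpace.norm_sq_eq, PiLp.inner_apply]
    push_cast
    rw [Finset.mul_sum, Finset.sum_mul, ← Finset.sum_sub_distrib, ← Finset.sum_sub_distrib]
    refine Finset.sum_congr rfl fun l _ => ?_
    apply Complex.ext
    · simp [hξ, imPart, pow_two]
    · simp [hξ, imPart, pow_two]
      ring
  rw [h1]
  refine (norm_sub_le _ _).trans ?_
  rw [norm_mul, Complex.norm_I, mul_one, Complex.norm_real, Complex.norm_real, norm_mul,
    Real.norm_of_nonneg (sq_nonneg _), Real.norm_ofNat, mul_assoc]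
  gcongr
  exact abs_real_inner_le_norm _ _

theorem refinedHadamardPetrowsky_parabolic {d k : ℕ} (hk : 1 ≤ k) :
    RefinedHadamardPetrowsky (parabolic d k) (2 * (k : ℝ)) := by
  have hk' : (1 : ℝ) ≤ k := by exact_mod_cast hk
  refine ⟨by linarith, ?_⟩
  obtain ⟨C, hC, hCb⟩ := exists_le_re_pow k
  refine ⟨(4 * π ^ 2) ^ k * C, by positivity, fun τ ζ h => ?_⟩
  obtain ⟨a, ha, hab⟩ := norm_sum_sq_sub_le ζ
  have h1 := hCb a _ _ ha (norm_nonneg _) hab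
  rw [parabolic_symbol] at h
  -- Real part of `iτ + (4π²ζ²)^k = 0`, where `Re (iτ) = -Im τ`.
  have h2 : τ.im = (4 * π ^ 2) ^ k * ((∑ l, ζ l ^ 2) ^ k).re := by
    have h3 := congrArg Complex.re h
    rw [mul_pow, show (4 * (π : ℂ) ^ 2) ^ k = (((4 * π ^ 2) ^ k : ℝ) : ℂ) by push_cast; rfl,
      Complex.add_re, Complex.re_ofReal_mul] at h3
    simp only [Complex.mul_re, Complex.I_re, Complex.I_im, Complex.zero_re] at h3
    linarith
  rw [h2, show (2 * (k : ℝ)) = ((2 * k : ℕ) : ℝ) by push_cast; rfl, Real.rpow_natCast]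
  have h4 : ‖imPart ζ‖ ^ (2 * k) ≤ (1 + ‖imPart ζ‖) ^ (2 * k) := by gcongr; linarith
  have h5 : 0 ≤ a ^ (2 * k) := by positivity
  have h6 : -C * (1 + ‖imPart ζ‖) ^ (2 * k) ≤ ((∑ l, ζ l ^ 2) ^ k).re := by nlinarith
  calc (4 * π ^ 2) ^ k * ((∑ l, ζ l ^ 2) ^ k).re
      ≥ (4 * π ^ 2) ^ k * (-C * (1 + ‖imPart ζ‖) ^ (2 * k)) := by gcongr
    _ = _ := by ring

/-! ### The action of the operator on exponentials -/

/-- The complex linear form `x ↦ 2πi ζ·x` on `ℝ^d`. -/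
noncomputable def waveForm {d : ℕ} (ζ : EuclideanSpace ℂ (Fin d)) : Space d →L[ℝ] ℂ :=
  (2 * π * Complex.I) • ∑ l, ζ l • Complex.ofRealCLM.comp (EuclideanSpace.proj l)

theorem waveForm_apply {d : ℕ} (ζ : EuclideanSpace ℂ (Fin d)) (x : Space d) :
    waveForm ζ x = 2 * π * Complex.I * ∑ l, ζ l * (x l : ℂ) := by
  simp [waveForm]

theorem waveForm_single {d : ℕ} (ζ : EuclideanSpace ℂ (Fin d)) (l : Fin d) :
    waveForm ζ (EuclideanSpace.single l 1) = 2 * π * Complex.I * ζ l := by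
  rw [waveForm_apply, Finset.sum_eq_single l]
  · simp
  · intro j _ hj
    simp [hj]
  · simp

theorem expWave_eq {d : ℕ} (s : ℂ) (ζ : EuclideanSpace ℂ (Fin d)) (t : ℝ) (x : Space d) :
    expWave s ζ t x = Complex.exp (s * t + waveForm ζ x) := by
  rw [expWave, waveForm_apply]

theorem contDiff_expWave {d : ℕ} (s : ℂ) (ζ : EuclideanSpace ℂ (Fin d)) (t : ℝ) {n : ℕ∞} :
    ContDiff ℝ n (expWave s ζ t) := by
  rw [show expWave s ζ t = _ from funext (expWave_eq s ζ t)]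
  exact ContDiff.cexp (contDiff_const.add (waveForm ζ).contDiff)

theorem hasFDerivAt_expWave {d : ℕ} (s : ℂ) (ζ : EuclideanSpace ℂ (Fin d)) (t : ℝ)
    (x : Space d) : HasFDerivAt (expWave s ζ t) (expWave s ζ t x • waveForm ζ) x := by
  rw [show expWave s ζ t = _ from funext (expWave_eq s ζ t)]
  exact ((waveForm ζ).hasFDerivAt.const_add (s * t)).cexp

/-- The second derivative of the exponential is the exponential times the square of the linear form
`waveForm ζ`. Its trace over the standard basis is `∑ (2πi ζ_l)²`. -/
theorem laplacian_expWave {d : ℕ} (s : ℂ) (ζ : EuclideanSpace ℂ (Fin d)) (t : ℝ) :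
    Δ (expWave s ζ t) = (-(4 * (π : ℂ) ^ 2 * ∑ l, ζ l ^ 2)) • expWave s ζ t := by
  rw [InnerProductSpace.laplacian_eq_iteratedFDeriv_orthonormalBasis _
    (EuclideanSpace.basisFun (Fin d) ℝ)]
  ext x
  have h1 : fderiv ℝ (expWave s ζ t) = fun x => expWave s ζ t x • waveForm ζ :=
    funext fun x => (hasFDerivAt_expWave s ζ t x).fderiv
  have h2 : fderiv ℝ (fun x => expWave s ζ t x • waveForm ζ) x =
      (expWave s ζ t x • waveForm ζ).smulRight (waveForm ζ) :=
    ((hasFDerivAt_expWave s ζ t x).smul_const (waveForm ζ)).fderiv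
  simp only [iteratedFDeriv_two_apply, h1, h2]
  simp only [EuclideanSpace.basisFun_apply, Matrix.cons_val_zero, Matrix.cons_val_one,
    ContinuousLinearMap.smulRight_apply, smul_apply, waveForm_single,
    smul_eq_mul, Pi.smul_apply]
  rw [← neg_mul, ← mul_neg, Finset.mul_sum, Finset.sum_mul]
  refine Finset.sum_congr rfl fun l _ => ?_
  linear_combination (4 * (π : ℂ) ^ 2 * ζ l ^ 2 * expWave s ζ t x) * Complex.I_sq

theorem iterate_neg_laplacian_expWave {d : ℕ} (s : ℂ) (ζ : EuclideanSpace ℂ (Fin d)) (t : ℝ)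
    (k : ℕ) : (fun f : Space d → ℂ => -(Δ f))^[k] (expWave s ζ t) =
      (4 * (π : ℂ) ^ 2 * ∑ l, ζ l ^ 2) ^ k • expWave s ζ t := by
  induction k with
  | zero => simp
  | succ k ih =>
    rw [Function.iterate_succ_apply', ih]
    ext x
    rw [Pi.neg_apply, InnerProductSpace.laplacian_smul _ (contDiff_expWave s ζ t).contDiffAt,
      laplacian_expWave]
    simp only [Pi.smul_apply, smul_eq_mul]
    ring

theorem parabolicAction_expWave {d k : ℕ} (s : ℂ) (ζ : EuclideanSpace ℂ (Fin d)) (t : ℝ)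
    (x : Space d) : parabolicAction d k (expWave s ζ) t x =
      (parabolic d k).symbol s ζ * expWave s ζ t x := by
  have h0 : HasDerivAt (fun t : ℝ => (t : ℂ)) 1 t := Complex.ofRealCLM.hasDerivAt
  have h1 : HasDerivAt (fun t : ℝ => expWave s ζ t x) (expWave s ζ t x * (s * 1)) t := by
    simp only [expWave_eq]
    exact ((h0.const_mul s).add_const _).cexp
  rw [parabolicAction, h1.deriv, iterate_neg_laplacian_expWave, parabolic_symbol, Pi.smul_apply,
    smul_eq_mul]
  ring

/-! ### Decay of Gelfand-Shilov functions -/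

theorem foldr_iterate_single {ι α : Type*} [DecidableEq ι] (F : ι → α → α) (j : ι) (n : ℕ)
    (l : List ι) (hl : l.Nodup) (a : α) :
    l.foldr (fun i h => (F i)^[(Pi.single j n : ι → ℕ) i] h) a =
      if j ∈ l then (F j)^[n] a else a := by
  induction l with
  | nil => simp
  | cons i l ih =>
    rw [List.nodup_cons] at hl
    rw [List.foldr_cons, ih hl.2]
    by_cases h : i = j
    · subst h
      simp [hl.1]
    · have h' : j ≠ i := fun e => h e.symm
      simp [h, h']

/-- Only multi-indices concentrated on one coordinate are needed from the Gelfand-Shilov estimates,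
because the largest coordinate controls the norm, for both `x` and `ξ`. -/
theorem multiDeriv_single {d : ℕ} (j : Fin d) (n : ℕ) (f : 𝓢(Space d, ℂ)) :
    multiDeriv (Pi.single j n) f =
      (fun v : 𝓢(Space d, ℂ) => ∂_{(EuclideanSpace.single j (1 : ℝ) : Space d)} v)^[n] f := by
  rw [multiDeriv, foldr_iterate_single _ j n _ (List.nodup_finRange d)]
  simp

theorem norm_fourier_iterate_lineDeriv {V : Type*} [NormedAddCommGroup V] [InnerProductSpace ℝ V]
    [FiniteDimensional ℝ V] [MeasurableSpace V] [BorelSpace V] (m : V) (n : ℕ) (f : 𝓢(V, ℂ))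
    (ξ : V) : ‖𝓕 ((fun v : 𝓢(V, ℂ) => ∂_{m} v)^[n] f) ξ‖ =
      (2 * π * |inner ℝ ξ m|) ^ n * ‖𝓕 f ξ‖ := by
  induction n with
  | zero => simp
  | succ n ih =>
    rw [Function.iterate_succ_apply', SchwartzMap.fourier_lineDerivOp_eq]
    rw [smul_apply, SchwartzMap.smulLeftCLM_apply_apply (by fun_prop), norm_smul,
      norm_smul, ih]
    simp [abs_of_pos Real.pi_pos]
    ring

/-- Some coordinate of a vector of `ℝ^d` has modulus at least `‖x‖ / d`. -/
theorem exists_norm_le_mul_abs {d : ℕ} (hd : 0 < d) (x : Space d) :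
    ∃ l, ‖x‖ ≤ d * |x l| := by
  have : Nonempty (Fin d) := ⟨⟨0, hd⟩⟩
  obtain ⟨l, hl⟩ := Finite.exists_max fun i => |x i|
  refine ⟨l, ?_⟩
  have h1 : ‖x‖ ^ 2 ≤ (d * |x l|) ^ 2 := by
    rw [EuclideanSpace.norm_sq_eq]
    calc ∑ i, ‖x i‖ ^ 2 ≤ ∑ _i : Fin d, |x l| ^ 2 :=
          Finset.sum_le_sum fun i _ => by
            rw [Real.norm_eq_abs]
            exact pow_le_pow_left₀ (abs_nonneg _) (hl i) 2
      _ = d * |x l| ^ 2 := by simp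
      _ ≤ (d * |x l|) ^ 2 := by
        rw [mul_pow]
        have : (1 : ℝ) ≤ d := by exact_mod_cast hd
        gcongr
        nlinarith
  exact le_of_sq_le_sq h1 (by positivity)

theorem prod_pow_single {d : ℕ} (x : Space d) (l : Fin d) (N : ℕ) :
    ∏ i, x i ^ (Pi.single l N : Fin d → ℕ) i = x l ^ N := by
  rw [Finset.prod_eq_single l]
  · simp
  · intro i _ hi
    simp [hi]
  · simp

theorem sum_single {d : ℕ} (l : Fin d) (N : ℕ) : ∑ i, (Pi.single l N : Fin d → ℕ) i = N := by
  simp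

theorem prod_factorial_single {d : ℕ} (l : Fin d) (N : ℕ) :
    ∏ i, ((Pi.single l N : Fin d → ℕ) i)! = N ! := by
  rw [Finset.prod_eq_single l]
  · simp
  · intro i _ hi
    simp [hi]
  · simp

/-- The moments of the pure derivatives of a Gelfand-Shilov function. -/
theorem exists_moment_bound_of_mem_gelfandShilov {d : ℕ} (hd : 0 < d) {s r : ℝ}
    {g : 𝓢(Space d, ℂ)} (hg : g ∈ gelfandShilov d s r) :
    ∃ K > 0, ∃ A > 0, ∃ B > 0, ∀ (N n : ℕ) (j : Fin d) (x : Space d),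
      ‖x‖ ^ N * ‖(fun v : 𝓢(Space d, ℂ) =>
        ∂_{(EuclideanSpace.single j (1 : ℝ) : Space d)} v)^[n] g x‖ ≤
      K * A ^ N * B ^ n * (N ! : ℝ) ^ r * (n ! : ℝ) ^ s := by
  obtain ⟨K, hK, A, hA, B, hB, h⟩ := hg
  have hd' : (0 : ℝ) < d := by exact_mod_cast hd
  refine ⟨K, hK, d * A, by positivity, B, hB, fun N n j x => ?_⟩
  obtain ⟨l, hl⟩ := exists_norm_le_mul_abs hd x
  have h1 := h (Pi.single l N) (Pi.single j n) x
  rw [prod_pow_single, sum_single, sum_single, prod_factorial_single, prod_factorial_single,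
    multiDeriv_single, norm_mul, Complex.norm_real, norm_pow, Real.norm_eq_abs] at h1
  calc _ ≤ (d * |x l|) ^ N * ‖(fun v : 𝓢(Space d, ℂ) =>
        ∂_{(EuclideanSpace.single j (1 : ℝ) : Space d)} v)^[n] g x‖ := by gcongr
    _ = d ^ N * (|x l| ^ N * ‖(fun v : 𝓢(Space d, ℂ) =>
        ∂_{(EuclideanSpace.single j (1 : ℝ) : Space d)} v)^[n] g x‖) := by ring
    _ ≤ d ^ N * (K * A ^ N * B ^ n * (N ! : ℝ) ^ r * (n ! : ℝ) ^ s) := by gcongr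
    _ = _ := by ring

/-- A Gelfand-Shilov function and its Fourier transform have stretched exponential decay. -/
theorem exists_decay_of_mem_gelfandShilov {d : ℕ} {r : ℝ} (hr : 0 < r) {g : 𝓢(Space d, ℂ)}
    (hg : g ∈ gelfandShilov d (1 / r) (1 / r)) :
    ∃ ε > 0, ∃ C > 0, ∀ x : Space d, ‖g x‖ ≤ C * Real.exp (-ε * ‖x‖ ^ r) ∧
      ‖𝓕 g x‖ ≤ C * Real.exp (-ε * ‖x‖ ^ r) := by
  -- In dimension `0` there is no coordinate to work with, but the space is a single point.
  rcases d.eq_zero_or_pos with rfl | hd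
  · refine ⟨1, one_pos, ‖g 0‖ + ‖𝓕 g 0‖ + 1, by positivity, fun x => ?_⟩
    rw [Subsingleton.elim x 0, norm_zero, Real.zero_rpow hr.ne']
    simp only [mul_zero, Real.exp_zero, mul_one]
    have := norm_nonneg (g 0)
    have := norm_nonneg (𝓕 g 0)
    constructor <;> linarith
  obtain ⟨K, hK, A, hA, B, hB, h⟩ := exists_moment_bound_of_mem_gelfandShilov hd hg
  obtain ⟨ε₁, hε₁, C₁, hC₁, hdecay₁⟩ := exists_exp_decay_of_moments hK hA hr
  have hg1 : ∀ x, ‖g x‖ ≤ C₁ * Real.exp (-ε₁ * ‖x‖ ^ r) := fun x =>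
    hdecay₁ _ _ (norm_nonneg _) fun N => by simpa using h N 0 ⟨0, hd⟩ x
  -- The weight `(1 + ‖x‖)^{-(d+1)}` is integrable. The moments of orders `0` and `M` thus bound the
  -- `L¹` norm of `∂_j^n g`, hence the sup norm of its Fourier transform, by a constant times `B^n
  -- (n!)^{1/r}`.
  set M : ℕ := d + 1 with hM
  set J : ℝ := ∫ x : Space d, (1 + ‖x‖) ^ (-(M : ℝ)) with hJ
  have hint : Integrable (fun x : Space d => (1 + ‖x‖) ^ (-(M : ℝ))) :=
    integrable_one_add_norm (by rw [hM]; simp)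
  have hJ0 : 0 ≤ J := integral_nonneg fun x => by positivity
  set K' : ℝ := 2 ^ M * (K + K * A ^ M * (M ! : ℝ) ^ (1 / r)) with hK'
  have hpoint : ∀ (n : ℕ) (j : Fin d) (x : Space d), ‖(fun v : 𝓢(Space d, ℂ) =>
      ∂_{(EuclideanSpace.single j (1 : ℝ) : Space d)} v)^[n] g x‖ ≤
      K' * B ^ n * (n ! : ℝ) ^ (1 / r) * (1 + ‖x‖) ^ (-(M : ℝ)) := by
    intro n j x
    have h0 := h 0 n j x
    have h1 := h M n j x
    rw [Real.rpow_neg (by positivity), Real.rpow_natCast, ← div_eq_mul_inv,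
      le_div_iff₀ (by positivity)]
    simp only [pow_zero, one_mul, mul_one, Nat.factorial_zero, Nat.cast_one, Real.one_rpow] at h0
    have h2 : (1 + ‖x‖) ^ M ≤ 2 ^ M * (1 + ‖x‖ ^ M) := by
      have h3 : (1 + ‖x‖) ≤ 2 * max 1 ‖x‖ := by
        linarith [le_max_left 1 ‖x‖, le_max_right 1 ‖x‖]
      calc (1 + ‖x‖) ^ M ≤ (2 * max 1 ‖x‖) ^ M := by gcongr
        _ = 2 ^ M * (max 1 ‖x‖) ^ M := mul_pow _ _ _
        _ ≤ _ := by
          gcongr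
          have h4 : 0 ≤ ‖x‖ ^ M := by positivity
          rcases max_choice 1 ‖x‖ with h5 | h5 <;> rw [h5]
          · rw [one_pow]; linarith
          · linarith
    set D := ‖(fun v : 𝓢(Space d, ℂ) =>
      ∂_{(EuclideanSpace.single j (1 : ℝ) : Space d)} v)^[n] g x‖
    calc D * (1 + ‖x‖) ^ M ≤ D * (2 ^ M * (1 + ‖x‖ ^ M)) := by gcongr
      _ = 2 ^ M * (D + ‖x‖ ^ M * D) := by ring
      _ ≤ 2 ^ M * (K * B ^ n * (n ! : ℝ) ^ (1 / r) +
          K * A ^ M * B ^ n * (M ! : ℝ) ^ (1 / r) * (n ! : ℝ) ^ (1 / r)) := by gcongr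
      _ = _ := by ring
  -- Derivatives of `g` become moments of `𝓕 g`, taken along the largest coordinate of `ξ`. The `+
  -- 1` makes the constant strictly positive.
  have hmom : ∀ (ξ : Space d) (n : ℕ), ‖ξ‖ ^ n * ‖𝓕 g ξ‖ ≤
      (K' * J + 1) * (d * B) ^ n * (n ! : ℝ) ^ (1 / r) := by
    intro ξ n
    obtain ⟨j, hj⟩ := exists_norm_le_mul_abs hd ξ
    have h1 : ‖𝓕 ((fun v : 𝓢(Space d, ℂ) =>
        ∂_{(EuclideanSpace.single j (1 : ℝ) : Space d)} v)^[n] g) ξ‖ ≤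
        K' * B ^ n * (n ! : ℝ) ^ (1 / r) * J := by
      rw [SchwartzMap.fourier_coe, Real.fourier_eq]
      refine (norm_integral_le_of_norm_le (hint.const_mul _) (.of_forall fun x => ?_)).trans
        (integral_const_mul _ _).le
      rw [Circle.norm_smul]
      exact hpoint n j x
    rw [norm_fourier_iterate_lineDeriv] at h1
    have h2 : |inner ℝ ξ (EuclideanSpace.single j (1 : ℝ) : Space d)| = |ξ j| := by
      simp [EuclideanSpace.inner_single_right]
    rw [h2] at h1
    have h3 : |ξ j| ≤ 2 * π * |ξ j| :=
      le_mul_of_one_le_left (abs_nonneg _) (by linarith [Real.pi_gt_three])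
    calc ‖ξ‖ ^ n * ‖𝓕 g ξ‖ ≤ (d * (2 * π * |ξ j|)) ^ n * ‖𝓕 g ξ‖ := by
          gcongr
          exact hj.trans (by gcongr)
      _ = d ^ n * ((2 * π * |ξ j|) ^ n * ‖𝓕 g ξ‖) := by rw [mul_pow]; ring
      _ ≤ d ^ n * (K' * B ^ n * (n ! : ℝ) ^ (1 / r) * J) := by gcongr
      _ = (K' * J) * (d * B) ^ n * (n ! : ℝ) ^ (1 / r) := by rw [mul_pow]; ring
      _ ≤ _ := by gcongr; linarith
  obtain ⟨ε₂, hε₂, C₂, hC₂, hdecay₂⟩ := exists_exp_decay_of_moments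
    (show 0 < K' * J + 1 by positivity) (show 0 < d * B by positivity) hr
  have hg2 : ∀ x, ‖𝓕 g x‖ ≤ C₂ * Real.exp (-ε₂ * ‖x‖ ^ r) := fun x =>
    hdecay₂ _ _ (norm_nonneg _) (hmom x)
  refine ⟨min ε₁ ε₂, by positivity, max C₁ C₂, by positivity, fun x =>
    ⟨(hg1 x).trans ?_, (hg2 x).trans ?_⟩⟩
  · gcongr
    exacts [le_max_left _ _, min_le_left _ _]
  · gcongr
    exacts [le_max_right _ _, min_le_right _ _]

/-! ### Holomorphic parameter integrals -/

/-- An integral depending holomorphically on a parameter, with a local majorant, is entire. -/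
theorem differentiable_integral_of_dominated {V : Type*} [TopologicalSpace V] [MeasurableSpace V]
    [OpensMeasurableSpace V] [SecondCountableTopology V] {μ : Measure V} {F : ℂ → V → ℂ}
    (hF : Continuous fun p : V × ℂ => F p.2 p.1) (hd : ∀ ξ, Differentiable ℂ fun τ => F τ ξ)
    (hb : ∀ R : ℝ, ∃ b : V → ℝ, Integrable b μ ∧ ∀ τ, ‖τ‖ ≤ R → ∀ ξ, ‖F τ ξ‖ ≤ b ξ) :
    Differentiable ℂ fun τ => ∫ ξ, F τ ξ ∂μ := by
  intro τ₀
  -- One unit for the neighbourhood of `τ₀` and one for the circle in Cauchy's estimate, so that the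
  -- same `b` also dominates the derivative in `τ`.
  obtain ⟨b, hbi, hbound⟩ := hb (‖τ₀‖ + 2)
  have hcont : ∀ τ, Continuous (F τ) := fun τ => hF.comp (by fun_prop : Continuous fun ξ => (ξ, τ))
  have hmeas : Measurable fun ξ => deriv (fun τ => F τ ξ) τ₀ :=
    (measurable_deriv_with_param (f := fun ξ τ => F τ ξ) hF).comp
      (measurable_id.prodMk measurable_const)
  refine (hasDerivAt_integral_of_dominated_loc_of_deriv_le (Metric.ball_mem_nhds τ₀ one_pos)
    (F' := fun τ ξ => deriv (fun τ => F τ ξ) τ) (bound := b)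
    (.of_forall fun τ => (hcont τ).aestronglyMeasurable)
    (hbi.mono' (hcont τ₀).aestronglyMeasurable
      (.of_forall fun ξ => hbound τ₀ (by linarith) ξ))
    hmeas.aestronglyMeasurable (.of_forall fun ξ τ hτ => ?_) hbi
    (.of_forall fun ξ τ _ => (hd ξ τ).hasDerivAt)).2.differentiableAt
  have h1 := Complex.norm_deriv_le_of_forall_mem_sphere_norm_le (c := τ) one_pos
    (hd ξ).diffContOnCl (C := b ξ) fun z hz => hbound z ?_ ξ
  · simpa using h1
  · rw [mem_sphere_iff_norm] at hz
    rw [mem_ball_iff_norm] at hτ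
    calc ‖z‖ = ‖τ₀ + (τ - τ₀) + (z - τ)‖ := by congr 1; ring
      _ ≤ ‖τ₀‖ + ‖τ - τ₀‖ + ‖z - τ‖ := norm_add₃_le
      _ ≤ ‖τ₀‖ + 2 := by linarith

/-- An entire function that is constant on the real line is constant. -/
theorem eq_of_differentiable_of_forall_real {f : ℂ → ℂ} (hf : Differentiable ℂ f) {c : ℂ}
    (h : ∀ p : ℝ, f p = c) (τ : ℂ) : f τ = c := by
  have h1 : AnalyticOnNhd ℂ f univ := fun z _ => hf.analyticAt z
  have h2 : AnalyticOnNhd ℂ (fun _ : ℂ => c) univ := analyticOnNhd_const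
  have h3 : Filter.Tendsto (fun p : ℝ => (p : ℂ)) (nhdsWithin 0 {0}ᶜ) (nhdsWithin 0 {0}ᶜ) := by
    refine tendsto_nhdsWithin_iff.2 ⟨?_, ?_⟩
    · have := (Complex.continuous_ofReal.tendsto 0).mono_left
        (nhdsWithin_le_nhds (s := ({0}ᶜ : Set ℝ)))
      simpa using this
    · filter_upwards [self_mem_nhdsWithin] with p hp
      simpa using hp
  have h4 : f = fun _ => c := h1.eq_of_frequently_eq h2 (z₀ := 0)
    (h3.frequently (Filter.Eventually.frequently (.of_forall h)))
  rw [h4]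

/-! ### The kernel of the propagator at time one -/

/-- The kernel `𝓕⁻¹ e^{-(4π² ‖ξ‖²)^k}` of the propagator at time one. -/
noncomputable def parabolicKernel (d k : ℕ) : Space d → ℂ :=
  𝓕⁻ fun ξ : Space d => Complex.exp (-(parabolicRate d k ξ : ℂ))

/-- The integrand of the inverse Fourier integral of `e^{-(4π² ‖ξ‖²)^k}` at `y`, at the complex
frequency `ξ + τ u`. -/
noncomputable def shiftedIntegrand {d : ℕ} (k : ℕ) (u y : Space d) (τ : ℂ) (ξ : Space d) : ℂ :=
  Complex.exp (-(((4 * π ^ 2) ^ k : ℝ) *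
      ((‖ξ‖ : ℂ) ^ 2 + 2 * (inner ℝ ξ u : ℝ) * τ + τ ^ 2) ^ k) +
    2 * π * Complex.I * ((inner ℝ ξ y : ℝ) + τ * (inner ℝ u y : ℝ)))

theorem shiftedIntegrand_ofReal {d k : ℕ} {u : Space d} (hu : ‖u‖ = 1) (y : Space d) (p : ℝ)
    (ξ : Space d) : shiftedIntegrand k u y p ξ = shiftedIntegrand k u y 0 (ξ + p • u) := by
  have h1 : ‖ξ + p • u‖ ^ 2 = ‖ξ‖ ^ 2 + 2 * inner ℝ ξ u * p + p ^ 2 := by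
    rw [norm_add_sq_real, inner_smul_right, norm_smul, hu, mul_one, Real.norm_eq_abs, sq_abs]
    ring
  have h2 : (‖ξ + p • u‖ : ℂ) ^ 2 = (‖ξ‖ : ℂ) ^ 2 + 2 * (inner ℝ ξ u : ℝ) * p + (p : ℂ) ^ 2 := by
    exact_mod_cast congrArg (fun x : ℝ => (x : ℂ)) h1
  rw [shiftedIntegrand, shiftedIntegrand, h2, inner_add_left (𝕜 := ℝ) ξ (p • u) y,
    real_inner_smul_left]
  push_cast
  simp only [mul_zero, zero_mul, add_zero, ne_eq, OfNat.ofNat_ne_zero, not_false_eq_true, zero_pow]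

theorem integral_shiftedIntegrand_zero {d k : ℕ} (u y : Space d) :
    ∫ ξ, shiftedIntegrand k u y 0 ξ = parabolicKernel d k y := by
  rw [parabolicKernel, Real.fourierInv_eq']
  congr 1
  ext ξ
  rw [shiftedIntegrand, smul_eq_mul, ← Complex.exp_add, parabolicRate]
  congr 1
  push_cast
  ring

/-- The modulus of the shifted integrand. -/
theorem exists_norm_shiftedIntegrand_le (d k : ℕ) : ∃ C : ℝ, 0 < C ∧
    ∀ (u y : Space d), ‖u‖ = 1 → ∀ (τ : ℂ) (ξ : Space d),
    ‖shiftedIntegrand k u y τ ξ‖ ≤ Real.exp (C * |τ.im| ^ (2 * k) - 2 * π * τ.im * inner ℝ u y) *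
      Real.exp (-((4 * π ^ 2) ^ k / 2) * ‖ξ + τ.re • u‖ ^ (2 * k)) := by
  obtain ⟨C, hC, hCb⟩ := exists_le_re_pow k
  refine ⟨(4 * π ^ 2) ^ k * C, by positivity, fun u y hu τ ξ => ?_⟩
  rw [shiftedIntegrand, Complex.norm_exp, ← Real.exp_add]
  gcongr
  -- This is the square of the complex frequency `ξ + τu`. `exists_le_re_pow` applies with `a = ‖ξ +
  -- (Re τ) u‖` and `b = |Im τ|`.
  set z : ℂ := (‖ξ‖ : ℂ) ^ 2 + 2 * (inner ℝ ξ u : ℝ) * τ + τ ^ 2 with hz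
  have h1 : ‖ξ + τ.re • u‖ ^ 2 = ‖ξ‖ ^ 2 + 2 * inner ℝ ξ u * τ.re + τ.re ^ 2 := by
    rw [norm_add_sq_real, inner_smul_right, norm_smul, hu, mul_one, Real.norm_eq_abs, sq_abs]
    ring
  have h2 : inner ℝ (ξ + τ.re • u) u = inner ℝ ξ u + τ.re := by
    rw [inner_add_left (𝕜 := ℝ), real_inner_smul_left, real_inner_self_eq_norm_sq, hu]
    ring
  have h3 : z - (‖ξ + τ.re • u‖ : ℂ) ^ 2 =
      ((2 * inner ℝ (ξ + τ.re • u) u * τ.im : ℝ) : ℂ) * Complex.I - ((τ.im ^ 2 : ℝ) : ℂ) := by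
    rw [← Complex.ofReal_pow, h1, h2, hz]
    conv_lhs => rw [← Complex.re_add_im τ]
    push_cast
    simp only [Complex.add_re, Complex.ofReal_re, Complex.re_ofReal_mul, Complex.I_re, mul_zero,
      add_zero]
    linear_combination ((τ.im : ℂ) ^ 2) * Complex.I_sq
  have h4 : ‖z - (‖ξ + τ.re • u‖ : ℂ) ^ 2‖ ≤ 2 * ‖ξ + τ.re • u‖ * |τ.im| + |τ.im| ^ 2 := by
    rw [h3]
    refine (norm_sub_le _ _).trans ?_
    rw [norm_mul, Complex.norm_I, mul_one, Complex.norm_real, Complex.norm_real, norm_mul, norm_mul,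
      Real.norm_of_nonneg (sq_nonneg _), Real.norm_ofNat, Real.norm_eq_abs τ.im, sq_abs]
    gcongr
    simpa [hu] using abs_real_inner_le_norm (ξ + τ.re • u) u
  have h5 := hCb _ _ z (norm_nonneg _) (abs_nonneg _) h4
  have h6 : (0 : ℝ) < (4 * π ^ 2) ^ k := by positivity
  have h7 : (2 * π * Complex.I * ((inner ℝ ξ y : ℝ) + τ * (inner ℝ u y : ℝ))).re =
      -(2 * π * τ.im * inner ℝ u y) := by
    simp
    ring
  rw [Complex.add_re, Complex.neg_re, Complex.re_ofReal_mul, h7]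
  have h8 := mul_le_mul_of_nonneg_left h5 h6.le
  linarith

theorem continuous_shiftedIntegrand {d k : ℕ} (u y : Space d) :
    Continuous fun p : Space d × ℂ => shiftedIntegrand k u y p.2 p.1 := by
  unfold shiftedIntegrand
  fun_prop

/-- Shift of the integration contour. For real `τ` the integral is unchanged by translation
invariance. It is entire in `τ`, so it is constant by the identity theorem. -/
theorem integral_shiftedIntegrand {d k : ℕ} (hk : 1 ≤ k) {u : Space d} (hu : ‖u‖ = 1)
    (y : Space d) (τ : ℂ) : ∫ ξ, shiftedIntegrand k u y τ ξ = parabolicKernel d k y := by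
  obtain ⟨C, hC, hCb⟩ := exists_norm_shiftedIntegrand_le d k
  refine eq_of_differentiable_of_forall_real
    (differentiable_integral_of_dominated (continuous_shiftedIntegrand u y) (fun ξ => ?_)
      fun R => ?_) (fun p => ?_) τ
  · unfold shiftedIntegrand
    fun_prop
  · set c : ℝ := (4 * π ^ 2) ^ k / 2 with hc
    have hc0 : 0 < c := by positivity
    refine ⟨fun ξ => Real.exp (C * R ^ (2 * k) + 2 * π * R * ‖y‖ + c * (R + 1)) *
      Real.exp (-c * ‖ξ‖ ^ (1 : ℝ)),
      (integrable_exp_neg_mul_norm_rpow volume hc0 le_rfl).const_mul _, fun τ hτ ξ => ?_⟩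
    refine (hCb u y hu τ ξ).trans ?_
    simp only [← Real.exp_add, Real.rpow_one]
    refine Real.exp_le_exp.2 ?_
    have hR : 0 ≤ R := (norm_nonneg τ).trans hτ
    have him : |τ.im| ≤ R := (Complex.abs_im_le_norm τ).trans hτ
    have hre : |τ.re| ≤ R := (Complex.abs_re_le_norm τ).trans hτ
    have h1 : |τ.im| ^ (2 * k) ≤ R ^ (2 * k) := by gcongr
    have h2 : -(τ.im * inner ℝ u y) ≤ R * ‖y‖ := by
      refine (neg_le_abs _).trans ?_
      rw [abs_mul]
      gcongr
      simpa [hu] using abs_real_inner_le_norm u y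
    have h3 : ‖ξ‖ ≤ R + 1 + ‖ξ + τ.re • u‖ ^ (2 * k) := by
      have h4 : ‖ξ‖ ≤ ‖ξ + τ.re • u‖ + ‖τ.re • u‖ := by
        simpa only [add_sub_cancel_right] using norm_sub_le (ξ + τ.re • u) (τ.re • u)
      rw [norm_smul, hu, mul_one, Real.norm_eq_abs] at h4
      have h5 := le_one_add_rpow (r := ((2 * k : ℕ) : ℝ)) (by norm_cast; omega)
        (norm_nonneg (ξ + τ.re • u))
      rw [Real.rpow_natCast] at h5
      linarith
    have h6 := mul_le_mul_of_nonneg_left h3 hc0.le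
    have h7 := mul_le_mul_of_nonneg_left h1 hC.le
    have h8 := mul_le_mul_of_nonneg_left h2 Real.two_pi_pos.le
    linarith
  · simp only [shiftedIntegrand_ofReal hu]
    rw [integral_add_right_eq_self (fun ξ => shiftedIntegrand k u y 0 ξ),
      integral_shiftedIntegrand_zero]

theorem integrable_exp_neg_parabolicRate {d k : ℕ} (hk : 1 ≤ k) :
    Integrable fun ξ : Space d => Complex.exp (-(parabolicRate d k ξ : ℂ)) := by
  have h1 := integrable_exp_neg_mul_norm_rpow (V := Space d) volume
    (show 0 < (4 * π ^ 2) ^ k by positivity) (r := ((2 * k : ℕ) : ℝ)) (by norm_cast; omega)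
  refine h1.mono' ?_ (.of_forall fun ξ => ?_)
  · unfold parabolicRate
    exact Continuous.aestronglyMeasurable (by fun_prop)
  · rw [Complex.norm_exp, parabolicRate, Real.rpow_natCast]
    simp only [Complex.neg_re, Complex.ofReal_re]
    rw [mul_pow, pow_mul]
    simp

/-- The kernel of the propagator decays like `e^{-ε |y|^{2k/(2k-1)}}`. -/
theorem exists_parabolicKernel_decay (d : ℕ) {k : ℕ} (hk : 1 ≤ k) : ∃ ε > 0, ∃ C > 0,
    ∀ y : Space d, ‖parabolicKernel d k y‖ ≤
      C * Real.exp (-ε * ‖y‖ ^ (2 * (k : ℝ) / (2 * (k : ℝ) - 1))) := by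
  obtain ⟨C, hC, hCb⟩ := exists_norm_shiftedIntegrand_le d k
  set c : ℝ := (4 * π ^ 2) ^ k / 2 with hc
  have hc0 : 0 < c := by positivity
  have hint := integrable_exp_neg_mul_norm_rpow (V := Space d) volume hc0
    (r := ((2 * k : ℕ) : ℝ)) (by norm_cast; omega)
  simp only [Real.rpow_natCast] at hint
  set J : ℝ := ∫ ξ : Space d, Real.exp (-c * ‖ξ‖ ^ (2 * k)) with hJ
  have hJ0 : 0 ≤ J := integral_nonneg fun _ => (Real.exp_pos _).le
  have hk' : (1 : ℝ) ≤ k := by exact_mod_cast hk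
  have hk1 : (0 : ℝ) < 2 * k - 1 := by linarith
  set r : ℝ := 2 * (k : ℝ) / (2 * (k : ℝ) - 1) with hr
  have hr0 : 0 < r := by positivity
  -- The shift will be `b = L ‖y‖^{1/(2k-1)}`, so that `b^{2k} = L^{2k} ‖y‖^r` and `b ‖y‖ = L
  -- ‖y‖^r`. From `L ≤ 1` and `C L ≤ π` follows `C L^{2k} ≤ C L² ≤ π L`, so the loss takes at most
  -- half of the gain `2πL`.
  set L : ℝ := min 1 (π / C) with hL
  have hL0 : 0 < L := by positivity
  have hL1 : L ≤ 1 := min_le_left _ _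
  have hLC : C * L ≤ π := by
    rw [← le_div_iff₀' hC]
    exact min_le_right _ _
  refine ⟨π * L, by positivity, J + ‖parabolicKernel d k 0‖ + 1, by positivity, fun y => ?_⟩
  rcases eq_or_ne y 0 with rfl | hy
  · rw [norm_zero, Real.zero_rpow hr0.ne', mul_zero, Real.exp_zero, mul_one]
    linarith
  have hy0 : 0 < ‖y‖ := norm_pos_iff.2 hy
  set u : Space d := ‖y‖⁻¹ • y with hu
  have hu1 : ‖u‖ = 1 := by
    rw [hu, norm_smul, norm_inv, norm_norm, inv_mul_cancel₀ hy0.ne']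
  have huy : inner ℝ u y = ‖y‖ := by
    rw [hu, real_inner_smul_left, real_inner_self_eq_norm_sq]
    field_simp
  set b : ℝ := L * ‖y‖ ^ (1 / (2 * (k : ℝ) - 1)) with hb
  have hb0 : 0 ≤ b := by positivity
  have hb1 : b * ‖y‖ = L * ‖y‖ ^ r := by
    rw [hb, mul_assoc, ← Real.rpow_add_one hy0.ne']
    congr 2
    rw [hr]
    field_simp
    ring
  have hb2 : b ^ (2 * k) = L ^ (2 * k) * ‖y‖ ^ r := by
    rw [hb, mul_pow, ← Real.rpow_natCast (‖y‖ ^ _), ← Real.rpow_mul hy0.le]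
    congr 2
    rw [hr]
    push_cast
    field_simp
  have hLpow : L ^ (2 * k) ≤ L * L := by
    rw [← pow_two]
    exact pow_le_pow_of_le_one hL0.le hL1 (by omega)
  rw [← integral_shiftedIntegrand hk hu1 y (b * Complex.I)]
  have h1 : ‖∫ ξ, shiftedIntegrand k u y (b * Complex.I) ξ‖ ≤
      Real.exp (C * b ^ (2 * k) - 2 * π * (b * ‖y‖)) * J := by
    refine (norm_integral_le_of_norm_le (hint.const_mul _) (.of_forall fun ξ => ?_)).trans
      (integral_const_mul _ _).le
    have h2 := hCb u y hu1 (b * Complex.I) ξ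
    simp only [Complex.re_ofReal_mul, Complex.im_ofReal_mul, Complex.I_re, Complex.I_im, mul_zero,
      mul_one, zero_smul, add_zero, abs_of_nonneg hb0, huy] at h2
    rwa [mul_assoc (2 * π)] at h2
  refine h1.trans ?_
  rw [mul_comm]
  gcongr
  · linarith [norm_nonneg (parabolicKernel d k 0)]
  · rw [hb1, hb2]
    have h3 : 0 ≤ ‖y‖ ^ r := by positivity
    have h4 : C * L ^ (2 * k) ≤ π * L := by nlinarith
    nlinarith

/-! ### Time-frequency shifts and the Fourier transform -/

theorem norm_tfShift {d : ℕ} (z : PhaseSpace d) (g : Space d → ℂ) (y : Space d) :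
    ‖tfShift z g y‖ = ‖g (y - z.fst)‖ := by
  rw [tfShift, norm_mul, Complex.norm_exp]
  simp

theorem continuous_tfShift {d : ℕ} (z : PhaseSpace d) {g : Space d → ℂ} (hg : Continuous g) :
    Continuous (tfShift z g) := by
  unfold tfShift
  fun_prop

theorem integrable_tfShift {d : ℕ} (z : PhaseSpace d) {g : Space d → ℂ} (hg : Continuous g)
    (hgi : Integrable g) : Integrable (tfShift z g) :=
  (hgi.comp_sub_right z.fst).mono (continuous_tfShift z hg).aestronglyMeasurable
    (.of_forall fun y => (norm_tfShift z g y).le)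

theorem fourier_tfShift {d : ℕ} (z : PhaseSpace d) (g : Space d → ℂ) (ξ : Space d) :
    𝓕 (tfShift z g) ξ =
      Complex.exp (-(2 * π * Complex.I * (inner ℝ z.fst (ξ - z.snd) : ℝ))) * 𝓕 g (ξ - z.snd) := by
  rw [Real.fourier_eq', Real.fourier_eq', ← integral_const_mul,
    ← integral_add_right_eq_self _ z.fst]
  congr 1
  ext y
  rw [tfShift, add_sub_cancel_right, smul_eq_mul, smul_eq_mul, ← mul_assoc, ← mul_assoc,
    ← Complex.exp_add, ← Complex.exp_add]
  congr 2
  simp only [inner_add_left (𝕜 := ℝ), inner_add_right (𝕜 := ℝ), inner_sub_right (𝕜 := ℝ),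
    real_inner_comm y z.snd, real_inner_comm z.fst z.snd]
  push_cast
  ring

theorem norm_fourier_tfShift {d : ℕ} (z : PhaseSpace d) (g : Space d → ℂ) (ξ : Space d) :
    ‖𝓕 (tfShift z g) ξ‖ = ‖𝓕 g (ξ - z.snd)‖ := by
  rw [fourier_tfShift, norm_mul, Complex.norm_exp]
  simp

theorem integrable_fourier_tfShift {d : ℕ} (z : PhaseSpace d) (g : 𝓢(Space d, ℂ)) :
    Integrable (𝓕 (tfShift z g)) := by
  have h1 : Integrable (𝓕 g : 𝓢(Space d, ℂ)) := (𝓕 g : 𝓢(Space d, ℂ)).integrable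
  have h2 : Continuous (𝓕 (g : Space d → ℂ)) := by
    rw [← SchwartzMap.fourier_coe]
    exact (𝓕 g : 𝓢(Space d, ℂ)).continuous
  rw [SchwartzMap.fourier_coe] at h1
  refine (h1.comp_sub_right z.snd).mono ?_ (.of_forall fun ξ => (norm_fourier_tfShift z g ξ).le)
  rw [show 𝓕 (tfShift z g) = _ from funext (fourier_tfShift z g)]
  exact Continuous.aestronglyMeasurable (by fun_prop)

/-- Parseval's formula for the entries of the Gabor matrix of a Fourier multiplier. -/
theorem gaborMatrix_eq_integral_fourier {d : ℕ} {σ : Space d → ℂ} (g : Space d → ℂ)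
    (z w : PhaseSpace d) (hσ : Integrable fun ξ => σ ξ * 𝓕 (tfShift z g) ξ)
    (hg : Integrable (tfShift w g)) :
    gaborMatrix σ g z w = ∫ ξ, σ ξ * 𝓕 (tfShift z g) ξ * conj (𝓕 (tfShift w g) ξ) := by
  have hc : Integrable fun y => conj (tfShift w g y) := Complex.conjLIE.integrable_comp_iff.2 hg
  -- The transform is moved from one factor to the other, for the pairing `-⟨·,·⟩`, so that it is
  -- the inverse Fourier transform on the left.
  have h := VectorFourier.integral_fourierIntegral_smul_eq_flip (e := 𝐞) (μ := volume)
    (ν := volume) (L := -innerₗ (Space d)) Real.continuous_fourierChar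
    (by simpa using! continuous_inner.neg) hσ hc
  have h1 : ∀ y, VectorFourier.fourierIntegral 𝐞 volume (-innerₗ (Space d))
      (fun ξ => σ ξ * 𝓕 (tfShift z g) ξ) y = multiplier σ (tfShift z g) y := by
    intro y
    rw [multiplier, Real.fourierInv_eq, VectorFourier.fourierIntegral]
    simp
  have h2 : ∀ ξ, VectorFourier.fourierIntegral 𝐞 volume (-innerₗ (Space d)).flip
      (fun y => conj (tfShift w g y)) ξ = conj (𝓕 (tfShift w g) ξ) := by
    intro ξ
    rw [Real.fourier_eq', ← integral_conj, VectorFourier.fourierIntegral]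
    congr 1
    ext y
    simp only [Circle.smul_def, Real.fourierChar_apply, smul_eq_mul, map_mul, ← Complex.exp_conj]
    congr 2
    simp [real_inner_comm, map_ofNat]
  simp only [h1, h2, smul_eq_mul] at h
  exact h

/-- The propagator as a superposition of translations. -/
theorem multiplier_fourier_comp_smul {d : ℕ} {K f : Space d → ℂ} (hK : Integrable K)
    (hf : Continuous f) (hfi : Integrable f) (hFi : Integrable (𝓕 f)) (s : ℝ) (y : Space d) :
    multiplier (fun ξ => 𝓕 K (s • ξ)) f y = ∫ v, K v * f (y - s • v) := by
  have hG : Integrable fun ξ => (𝐞 (inner ℝ ξ y) • 𝓕 f ξ : ℂ) := by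
    refine hFi.mono ?_ (.of_forall fun ξ => (Circle.norm_smul _ _).le)
    refine AEStronglyMeasurable.smul (Continuous.aestronglyMeasurable ?_) hFi.1
    have h1 : Continuous fun ξ : Space d => (inner ℝ ξ y : ℝ) := by fun_prop
    exact continuous_subtype_val.comp (Real.continuous_fourierChar.comp h1)
  -- Using the pairing `s⟨·,·⟩` builds the dilation into the transform. No change of variables is
  -- needed, and `s = 0` is allowed.
  have h := VectorFourier.integral_fourierIntegral_smul_eq_flip (e := 𝐞) (μ := volume)
    (ν := volume) (L := s • innerₗ (Space d)) Real.continuous_fourierChar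
    (by simpa using! continuous_inner.const_smul s) hK hG
  have h1 : ∀ ξ, VectorFourier.fourierIntegral 𝐞 volume (s • innerₗ (Space d)) K ξ =
      𝓕 K (s • ξ) := by
    intro ξ
    rw [Real.fourier_eq, VectorFourier.fourierIntegral]
    simp [inner_smul_right]
  have h2 : ∀ v, VectorFourier.fourierIntegral 𝐞 volume (s • innerₗ (Space d)).flip
      (fun ξ => (𝐞 (inner ℝ ξ y) • 𝓕 f ξ : ℂ)) v = f (y - s • v) := by
    intro v
    rw [← congrFun (hf.fourierInv_fourier_eq hfi hFi) (y - s • v), Real.fourierInv_eq,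
      VectorFourier.fourierIntegral]
    congr 1
    ext ξ
    rw [smul_smul, ← AddChar.map_add_eq_mul]
    congr 2
    simp only [LinearMap.flip_apply, LinearMap.smul_apply, innerₗ_apply_apply, smul_eq_mul,
      inner_sub_right (𝕜 := ℝ), inner_smul_right, real_inner_comm ξ v]
    ring
  simp only [h1, h2, smul_eq_mul] at h
  rw [multiplier, Real.fourierInv_eq, ← h]
  congr 1
  ext ξ
  simp only [Circle.smul_def, smul_eq_mul]
  ring

theorem continuous_exp_neg_parabolicRate (d k : ℕ) :
    Continuous fun ξ : Space d => Complex.exp (-(parabolicRate d k ξ : ℂ)) := by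
  unfold parabolicRate
  fun_prop

theorem integrable_parabolicKernel (d : ℕ) {k : ℕ} (hk : 1 ≤ k) :
    Integrable (parabolicKernel d k) := by
  obtain ⟨ε, hε, C, hC, h⟩ := exists_parabolicKernel_decay d hk
  have hk' : (1 : ℝ) ≤ k := by exact_mod_cast hk
  refine ((integrable_exp_neg_mul_norm_rpow volume hε ?_).const_mul C).mono' ?_ (.of_forall h)
  · rw [le_div_iff₀ (by linarith)]
    linarith
  · refine Continuous.aestronglyMeasurable ?_
    rw [parabolicKernel, Real.fourierInv_eq_fourier_comp_neg]
    exact VectorFourier.fourierIntegral_continuous Real.continuous_fourierChar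
      (by simpa using! continuous_inner) ((integrable_exp_neg_parabolicRate hk).comp_neg)

theorem fourier_parabolicKernel {d k : ℕ} (hk : 1 ≤ k) (ξ : Space d) :
    𝓕 (parabolicKernel d k) ξ = Complex.exp (-(parabolicRate d k ξ : ℂ)) := by
  have h1 : Integrable (𝓕 fun ξ : Space d => Complex.exp (-(parabolicRate d k ξ : ℂ))) := by
    refine (integrable_parabolicKernel d hk).comp_neg.congr (.of_forall fun y => ?_)
    simp only [parabolicKernel, Real.fourierInv_eq_fourier_neg, neg_neg]
  exact congrFun ((continuous_exp_neg_parabolicRate d k).fourier_fourierInv_eq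
    (integrable_exp_neg_parabolicRate hk) h1) ξ

/-- Homogeneity of degree `2k` absorbs `t` into a dilation of `ξ`, so the kernel at time one serves
all times, including `t = 0`. -/
theorem parabolicSymbol_eq_fourier {d k : ℕ} (hk : 1 ≤ k) {t : ℝ} (ht : 0 ≤ t) :
    parabolicSymbol d k t =
      fun ξ => 𝓕 (parabolicKernel d k) (t ^ (1 / (2 * (k : ℝ))) • ξ) := by
  ext ξ
  rw [parabolicSymbol, if_pos ht, fourier_parabolicKernel hk]
  congr 2
  rw [← Complex.ofReal_mul]
  congr 1
  rw [parabolicRate, parabolicRate, norm_smul, Real.norm_of_nonneg (by positivity)]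
  have hk' : (k : ℝ) ≠ 0 := by positivity
  have h1 : (t ^ (1 / (2 * (k : ℝ)))) ^ (2 * k) = t := by
    rw [← Real.rpow_natCast, ← Real.rpow_mul ht]
    push_cast
    rw [one_div_mul_cancel (by positivity), Real.rpow_one]
  calc (4 * π ^ 2 * ‖ξ‖ ^ 2) ^ k * t
      = (4 * π ^ 2 * ‖ξ‖ ^ 2) ^ k * (t ^ (1 / (2 * (k : ℝ)))) ^ (2 * k) := by rw [h1]
    _ = _ := by rw [pow_mul, ← mul_pow]; ring

theorem norm_parabolicSymbol_le {d k : ℕ} {t : ℝ} (ξ : Space d) :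
    ‖parabolicSymbol d k t ξ‖ ≤ 1 := by
  rw [parabolicSymbol]
  split_ifs with ht
  · rw [← Complex.ofReal_mul, ← Complex.ofReal_neg, Complex.norm_exp_ofReal, Real.exp_le_one_iff,
      neg_nonpos, parabolicRate]
    positivity
  · simp

/-! ### Decay of the Gabor matrix -/

section Decay

variable {d k : ℕ} {r ε C : ℝ} {g : 𝓢(Space d, ℂ)}

/-- Decay of the Gabor matrix in the frequency variables. -/
theorem norm_gaborMatrix_le_frequency (hr : 1 ≤ r) (hε : 0 < ε) (hC : 0 < C)
    (hg : ∀ x, ‖𝓕 g x‖ ≤ C * Real.exp (-ε * ‖x‖ ^ r)) {t : ℝ} (z w : PhaseSpace d) :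
    ‖gaborMatrix (parabolicSymbol d k t) g z w‖ ≤
      (C ^ 2 * ∫ x : Space d, Real.exp (-(ε / 2) * ‖x‖ ^ r)) *
        Real.exp (-(ε / (2 * 2 ^ r)) * ‖w.snd - z.snd‖ ^ r) := by
  have hFi := integrable_fourier_tfShift z g
  have hmeas : AEStronglyMeasurable (parabolicSymbol d k t) volume := by
    unfold parabolicSymbol parabolicRate
    split_ifs
    · exact Continuous.aestronglyMeasurable (by fun_prop)
    · exact aestronglyMeasurable_const
  have hσ : Integrable fun ξ => parabolicSymbol d k t ξ * 𝓕 (tfShift z g) ξ := by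
    refine hFi.mono (hmeas.mul hFi.1) (.of_forall fun ξ => ?_)
    rw [norm_mul]
    exact mul_le_of_le_one_left (norm_nonneg _) (norm_parabolicSymbol_le ξ)
  rw [gaborMatrix_eq_integral_fourier _ z w hσ (integrable_tfShift w g.continuous g.integrable)]
  have hint := (integrable_exp_neg_mul_norm_rpow (V := Space d) volume (half_pos hε) hr).comp_sub_right
    z.snd
  rw [← integral_sub_right_eq_self (fun x : Space d => Real.exp (-(ε / 2) * ‖x‖ ^ r)) z.snd,
    mul_right_comm, ← integral_const_mul]
  refine norm_integral_le_of_norm_le (hint.const_mul _) (.of_forall fun ξ => ?_)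
  rw [norm_mul, norm_mul, RCLike.norm_conj, norm_fourier_tfShift, norm_fourier_tfShift]
  have h1 := hg (ξ - z.snd)
  have h2 := hg (ξ - w.snd)
  rw [SchwartzMap.fourier_coe] at h1 h2
  have h3 : ‖w.snd - z.snd‖ ^ r ≤ 2 ^ r * (‖ξ - z.snd‖ ^ r + ‖ξ - w.snd‖ ^ r) := by
    have := norm_add_rpow_le (zero_le_one.trans hr) (ξ - z.snd) (-(ξ - w.snd))
    rwa [norm_neg, show ξ - z.snd + -(ξ - w.snd) = w.snd - z.snd by abel] at this
  -- Half of the available exponent pays for the decay in `w - z`. The other half keeps the integral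
  -- over `ξ` convergent.
  have h4 : ε / (2 * 2 ^ r) * ‖w.snd - z.snd‖ ^ r ≤
      ε / 2 * (‖ξ - z.snd‖ ^ r + ‖ξ - w.snd‖ ^ r) := by
    calc _ ≤ ε / (2 * 2 ^ r) * (2 ^ r * (‖ξ - z.snd‖ ^ r + ‖ξ - w.snd‖ ^ r)) := by gcongr
      _ = _ := by field_simp
  have h5 : 0 ≤ ε / 2 * ‖ξ - w.snd‖ ^ r := by positivity
  calc ‖parabolicSymbol d k t ξ‖ * ‖𝓕 (g : Space d → ℂ) (ξ - z.snd)‖ *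
        ‖𝓕 (g : Space d → ℂ) (ξ - w.snd)‖
      ≤ 1 * (C * Real.exp (-ε * ‖ξ - z.snd‖ ^ r)) * (C * Real.exp (-ε * ‖ξ - w.snd‖ ^ r)) := by
        gcongr
        exact norm_parabolicSymbol_le ξ
    _ = C ^ 2 * Real.exp (-ε * ‖ξ - z.snd‖ ^ r + -ε * ‖ξ - w.snd‖ ^ r) := by
        rw [Real.exp_add]; ring
    _ ≤ C ^ 2 * Real.exp (-(ε / (2 * 2 ^ r)) * ‖w.snd - z.snd‖ ^ r +
          -(ε / 2) * ‖ξ - z.snd‖ ^ r) := by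
        refine mul_le_mul_of_nonneg_left (Real.exp_le_exp.2 ?_) (by positivity)
        linarith
    _ = _ := by rw [Real.exp_add]; ring

/-- Decay of the Gabor matrix in the space variables. -/
theorem norm_gaborMatrix_le_space (hk : 1 ≤ k) (hr : 1 ≤ r) (hε : 0 < ε) (hC : 0 < C)
    (hg : ∀ x, ‖g x‖ ≤ C * Real.exp (-ε * ‖x‖ ^ r))
    (hK : ∀ x, ‖parabolicKernel d k x‖ ≤ C * Real.exp (-ε * ‖x‖ ^ r)) {t R : ℝ} (ht : 0 ≤ t)
    (htR : t ^ (1 / (2 * (k : ℝ))) ≤ R) (z w : PhaseSpace d) :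
    ‖gaborMatrix (parabolicSymbol d k t) g z w‖ ≤
      (C ^ 3 * (∫ x : Space d, Real.exp (-(ε / 2) * ‖x‖ ^ r)) ^ 2) *
        Real.exp (-(ε / (2 * (2 ^ r * 2 ^ r * (R ^ r + 1)))) * ‖w.fst - z.fst‖ ^ r) := by
  set s : ℝ := t ^ (1 / (2 * (k : ℝ))) with hs
  have hs0 : 0 ≤ s := by positivity
  have hr0 : 0 ≤ r := zero_le_one.trans hr
  have hR0 : 0 ≤ R := hs0.trans htR
  set D : ℝ := 2 ^ r * 2 ^ r * (R ^ r + 1) with hD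
  have hD0 : 0 < D := by positivity
  set J : ℝ := ∫ x : Space d, Real.exp (-(ε / 2) * ‖x‖ ^ r) with hJ
  set E : ℝ := Real.exp (-(ε / (2 * D)) * ‖w.fst - z.fst‖ ^ r) with hE
  have hint := integrable_exp_neg_mul_norm_rpow (V := Space d) volume (half_pos hε) hr
  have hpoint : ∀ y v : Space d,
      ‖parabolicKernel d k v * tfShift z g (y - s • v) * conj (tfShift w g y)‖ ≤
      C ^ 3 * E * Real.exp (-(ε / 2) * ‖y - w.fst‖ ^ r) * Real.exp (-(ε / 2) * ‖v‖ ^ r) := by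
    intro y v
    rw [norm_mul, norm_mul, RCLike.norm_conj, norm_tfShift, norm_tfShift]
    set a : ℝ := ‖v‖ ^ r with ha
    set b : ℝ := ‖y - s • v - z.fst‖ ^ r with hb
    set c : ℝ := ‖y - w.fst‖ ^ r with hc
    have ha0 : 0 ≤ a := by positivity
    have hb0 : 0 ≤ b := by positivity
    have hc0 : 0 ≤ c := by positivity
    -- The separation splits as `(y - sv - z) + sv - (y - w)`, and each piece is penalized by one of
    -- the three decaying factors. `R^r + 1` dominates both `s^r` and `1`.
    have h1 : ‖w.fst - z.fst‖ ^ r ≤ D * (a + b + c) := by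
      have h2 := norm_add_rpow_le hr0 (y - s • v - z.fst) (s • v + -(y - w.fst))
      have h3 := norm_add_rpow_le hr0 (s • v) (-(y - w.fst))
      rw [norm_neg, norm_smul, Real.norm_of_nonneg hs0, Real.mul_rpow hs0 (norm_nonneg v)] at h3
      rw [show y - s • v - z.fst + (s • v + -(y - w.fst)) = w.fst - z.fst by abel] at h2
      have h4 : s ^ r ≤ R ^ r := by gcongr
      have h5 : (1 : ℝ) ≤ 2 ^ r := Real.one_le_rpow (by norm_num) hr0
      have h6 : 0 ≤ R ^ r := by positivity
      calc ‖w.fst - z.fst‖ ^ r ≤ 2 ^ r * (b + 2 ^ r * (s ^ r * a + c)) :=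
            h2.trans (by gcongr)
        _ ≤ 2 ^ r * (2 ^ r * ((R ^ r + 1) * b) + 2 ^ r * ((R ^ r + 1) * a + (R ^ r + 1) * c)) := by
          gcongr
          · calc b ≤ (R ^ r + 1) * b := le_mul_of_one_le_left hb0 (by linarith)
              _ ≤ 2 ^ r * ((R ^ r + 1) * b) := le_mul_of_one_le_left (by positivity) h5
          · linarith
          · exact le_mul_of_one_le_left hc0 (by linarith)
        _ = _ := by rw [hD]; ring
    have h7 : ε / (2 * D) * ‖w.fst - z.fst‖ ^ r ≤ ε / 2 * (a + b + c) := by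
      calc _ ≤ ε / (2 * D) * (D * (a + b + c)) := by gcongr
        _ = _ := by field_simp
    have h8 : 0 ≤ ε / 2 * b := by positivity
    calc ‖parabolicKernel d k v‖ * ‖g (y - s • v - z.fst)‖ * ‖g (y - w.fst)‖
        ≤ C * Real.exp (-ε * a) * (C * Real.exp (-ε * b)) * (C * Real.exp (-ε * c)) := by
          gcongr
          exacts [hK v, hg _, hg _]
      _ = C ^ 3 * Real.exp (-ε * a + -ε * b + -ε * c) := by
          rw [Real.exp_add, Real.exp_add]; ring
      _ ≤ C ^ 3 * Real.exp (-(ε / (2 * D)) * ‖w.fst - z.fst‖ ^ r + -(ε / 2) * c +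
            -(ε / 2) * a) := by
          refine mul_le_mul_of_nonneg_left (Real.exp_le_exp.2 ?_) (by positivity)
          linarith
      _ = _ := by rw [Real.exp_add, Real.exp_add, hE]; ring
  have hinner : ∀ y : Space d,
      ‖multiplier (parabolicSymbol d k t) (tfShift z g) y * conj (tfShift w g y)‖ ≤
      C ^ 3 * E * J * Real.exp (-(ε / 2) * ‖y - w.fst‖ ^ r) := by
    intro y
    rw [parabolicSymbol_eq_fourier hk ht, multiplier_fourier_comp_smul
      (integrable_parabolicKernel d hk) (continuous_tfShift z g.continuous)
      (integrable_tfShift z g.continuous g.integrable) (integrable_fourier_tfShift z g),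
      ← integral_mul_const, mul_right_comm, ← integral_const_mul]
    exact norm_integral_le_of_norm_le (hint.const_mul _) (.of_forall (hpoint y))
  rw [gaborMatrix]
  refine (norm_integral_le_of_norm_le ((hint.comp_sub_right w.fst).const_mul (C ^ 3 * E * J))
    (.of_forall hinner)).trans (le_of_eq ?_)
  rw [integral_const_mul,
    integral_sub_right_eq_self (fun x : Space d => Real.exp (-(ε / 2) * ‖x‖ ^ r)) w.fst]
  ring

end Decay

theorem norm_rpow_phaseSpace_le {d : ℕ} {r : ℝ} (hr : 0 ≤ r) (z : PhaseSpace d) :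
    ‖z‖ ^ r ≤ 2 ^ r * max (‖z.fst‖ ^ r) (‖z.snd‖ ^ r) := by
  have h1 : ‖z‖ ≤ 2 * max ‖z.fst‖ ‖z.snd‖ := by
    refine le_of_sq_le_sq ?_ (by positivity)
    rw [WithLp.prod_norm_sq_eq_of_L2]
    have h2 : ‖z.fst‖ ^ 2 ≤ (max ‖z.fst‖ ‖z.snd‖) ^ 2 := by gcongr; exact le_max_left _ _
    have h3 : ‖z.snd‖ ^ 2 ≤ (max ‖z.fst‖ ‖z.snd‖) ^ 2 := by gcongr; exact le_max_right _ _
    nlinarith [sq_nonneg (max ‖z.fst‖ ‖z.snd‖)]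
  calc ‖z‖ ^ r ≤ (2 * max ‖z.fst‖ ‖z.snd‖) ^ r := by gcongr
    _ = 2 ^ r * (max ‖z.fst‖ ‖z.snd‖) ^ r := Real.mul_rpow (by norm_num) (by positivity)
    _ ≤ _ := by
      gcongr
      rcases max_choice ‖z.fst‖ ‖z.snd‖ with h | h <;> rw [h]
      exacts [le_max_left _ _, le_max_right _ _]

/-- Whichever of the spatial and frequency separations is larger controls `‖w - z‖` up to a factor
`2`. The corresponding one-sided estimate then suffices. -/
theorem exists_gaborMatrix_decay {d k : ℕ} (hk : 1 ≤ k) {r : ℝ}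
    (hr : r = 2 * (k : ℝ) / (2 * (k : ℝ) - 1)) {g : 𝓢(Space d, ℂ)}
    (hg : g ∈ gelfandShilov d (1 / r) (1 / r)) {S : Set ℝ} (hS : S ⊆ Ici 0)
    (hSb : Bornology.IsBounded S) :
    ∃ ε > 0, ∃ C > 0, ∀ t ∈ S, ∀ z w : PhaseSpace d,
      ‖gaborMatrix (parabolicSymbol d k t) g z w‖ ≤ C * Real.exp (-ε * ‖w - z‖ ^ r) := by
  have hk' : (1 : ℝ) ≤ k := by exact_mod_cast hk
  have hr1 : 1 ≤ r := by
    rw [hr, le_div_iff₀ (by linarith)]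
    linarith
  have hr0 : 0 < r := by linarith
  obtain ⟨ε₁, hε₁, C₁, hC₁, hgd⟩ := exists_decay_of_mem_gelfandShilov hr0 hg
  obtain ⟨ε₂, hε₂, C₂, hC₂, hKd⟩ := exists_parabolicKernel_decay d hk
  rw [← hr] at hKd
  obtain ⟨T, hT⟩ := hSb.subset_closedBall 0
  -- The radius `T` may be negative when `S` is empty, hence the absolute value.
  set R : ℝ := |T| ^ (1 / (2 * (k : ℝ))) with hR
  set ε : ℝ := min ε₁ ε₂ with hε
  set C : ℝ := max C₁ C₂ with hC
  have hε0 : 0 < ε := by positivity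
  have hC0 : 0 < C := by positivity
  have hle₁ : ∀ x : Space d, C₁ * Real.exp (-ε₁ * ‖x‖ ^ r) ≤ C * Real.exp (-ε * ‖x‖ ^ r) := by
    intro x
    gcongr
    exacts [le_max_left _ _, min_le_left _ _]
  have hle₂ : ∀ x : Space d, C₂ * Real.exp (-ε₂ * ‖x‖ ^ r) ≤ C * Real.exp (-ε * ‖x‖ ^ r) := by
    intro x
    gcongr
    exacts [le_max_right _ _, min_le_right _ _]
  set J : ℝ := ∫ x : Space d, Real.exp (-(ε / 2) * ‖x‖ ^ r) with hJ
  have hJ0 : 0 ≤ J := integral_nonneg fun _ => (Real.exp_pos _).le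
  set δ₁ : ℝ := ε / (2 * 2 ^ r) with hδ₁
  set δ₂ : ℝ := ε / (2 * (2 ^ r * 2 ^ r * (R ^ r + 1))) with hδ₂
  have hδ₁0 : 0 < δ₁ := by positivity
  have hδ₂0 : 0 < δ₂ := by positivity
  refine ⟨min δ₁ δ₂ / 2 ^ r, by positivity, C ^ 2 * J + C ^ 3 * J ^ 2 + 1, by positivity,
    fun t ht z w => ?_⟩
  have ht0 : 0 ≤ t := hS ht
  have htR : t ^ (1 / (2 * (k : ℝ))) ≤ R := by
    have h1 := hT ht
    rw [Metric.mem_closedBall, dist_zero_right, Real.norm_of_nonneg ht0] at h1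
    rw [hR]
    gcongr
    exact h1.trans (le_abs_self T)
  have hfreq := norm_gaborMatrix_le_frequency (k := k) hr1 hε0 hC0
    (fun x => (hgd x).2.trans (hle₁ x)) (t := t) z w
  have hspace := norm_gaborMatrix_le_space hk hr1 hε0 hC0 (fun x => (hgd x).1.trans (hle₁ x))
    (fun x => (hKd x).trans (hle₂ x)) ht0 htR z w
  rw [← hδ₁] at hfreq
  rw [← hδ₂] at hspace
  have hnorm : min δ₁ δ₂ / 2 ^ r * ‖w - z‖ ^ r ≤
      min δ₁ δ₂ * max (‖w.fst - z.fst‖ ^ r) (‖w.snd - z.snd‖ ^ r) := by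
    have h2 : (0 : ℝ) < 2 ^ r := by positivity
    calc _ ≤ min δ₁ δ₂ / 2 ^ r *
          (2 ^ r * max (‖w.fst - z.fst‖ ^ r) (‖w.snd - z.snd‖ ^ r)) := by
            gcongr
            exact norm_rpow_phaseSpace_le hr0.le (w - z)
      _ = _ := by field_simp
  rcases max_choice (‖w.fst - z.fst‖ ^ r) (‖w.snd - z.snd‖ ^ r) with h | h <;> rw [h] at hnorm
  · refine hspace.trans ?_
    have h3 : min δ₁ δ₂ * ‖w.fst - z.fst‖ ^ r ≤ δ₂ * ‖w.fst - z.fst‖ ^ r := by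
      gcongr
      exact min_le_right _ _
    refine mul_le_mul ?_ (Real.exp_le_exp.2 ?_) (Real.exp_pos _).le (by positivity)
    · have : 0 ≤ C ^ 2 * J := by positivity
      linarith
    · linarith
  · refine hfreq.trans ?_
    have h3 : min δ₁ δ₂ * ‖w.snd - z.snd‖ ^ r ≤ δ₁ * ‖w.snd - z.snd‖ ^ r := by
      gcongr
      exact min_le_left _ _
    refine mul_le_mul ?_ (Real.exp_le_exp.2 ?_) (Real.exp_pos _).le (by positivity)
    · have : 0 ≤ C ^ 3 * J ^ 2 := by positivity
      linarith
    · linarith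

end GaborParabolic

theorem mainTheorem3 (d : ℕ) :
    (∀ k : ℕ, 1 ≤ k →
      -- the polynomial attached to `∂_t + (-Δ)^k` is its symbol `s + (4π² ζ²)^k`
      (∀ (s : ℂ) (ζ : EuclideanSpace ℂ (Fin d)),
        (parabolic d k).symbol s ζ = s + (4 * (π : ℂ) ^ 2 * ∑ l, ζ l ^ 2) ^ k ∧
        ∀ (t : ℝ) (x : Space d), parabolicAction d k (expWave s ζ) t x =
          (parabolic d k).symbol s ζ * expWave s ζ t x) ∧
      -- the refined Hadamard-Petrowsky condition with `ν = 2k`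
      RefinedHadamardPetrowsky (parabolic d k) (2 * (k : ℝ)) ∧
      -- the value of the decay exponent `r = min {2, ν / (ν - 1)}`
      min 2 (2 * (k : ℝ) / (2 * (k : ℝ) - 1)) = 2 * (k : ℝ) / (2 * (k : ℝ) - 1) ∧
      -- the symbol of the propagator, and the decay of the Gabor matrix
      (∃! σ : ℝ → Space d → ℂ, IsFundamentalSymbol (parabolic d k) σ) ∧
      ∀ σ : ℝ → Space d → ℂ, IsFundamentalSymbol (parabolic d k) σ →
        ∀ r : ℝ, r = 2 * (k : ℝ) / (2 * (k : ℝ) - 1) →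
        ∀ g ∈ gelfandShilov d (1 / r) (1 / r),
        ∀ S : Set ℝ, S ⊆ Ici 0 → Bornology.IsBounded S →
          ∃ ε > 0, ∃ C > 0, ∀ t ∈ S, ∀ z w : PhaseSpace d,
            ‖gaborMatrix (σ t) g z w‖ ≤ C * Real.exp (-ε * ‖w - z‖ ^ r)) ∧
    -- the heat propagator
    IsFundamentalSymbol (parabolic d 1) (heatSymbol d) ∧
    ∀ g ∈ gelfandShilov d (1 / 2) (1 / 2),
      ∀ S : Set ℝ, S ⊆ Ici 0 → Bornology.IsBounded S →
        ∃ ε > 0, ∃ C > 0, ∀ t ∈ S, ∀ z w : PhaseSpace d,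
          ‖gaborMatrix (heatSymbol d t) g z w‖ ≤ C * Real.exp (-ε * ‖w - z‖ ^ 2) := by
  have hpar : ∀ k : ℕ, 1 ≤ k → ∀ r : ℝ, r = 2 * (k : ℝ) / (2 * (k : ℝ) - 1) →
      ∀ g ∈ gelfandShilov d (1 / r) (1 / r), ∀ S : Set ℝ, S ⊆ Ici 0 → Bornology.IsBounded S →
        ∃ ε > 0, ∃ C > 0, ∀ t ∈ S, ∀ z w : PhaseSpace d,
          ‖gaborMatrix (parabolicSymbol d k t) g z w‖ ≤ C * Real.exp (-ε * ‖w - z‖ ^ r) :=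
    fun k hk r hr g hg S hS hSb => exists_gaborMatrix_decay hk hr hg hS hSb
  refine ⟨fun k hk => ⟨fun s ζ => ⟨parabolic_symbol s ζ, parabolicAction_expWave s ζ⟩,
    refinedHadamardPetrowsky_parabolic hk, ?_, ?_, fun σ hσ => ?_⟩, ?_, fun g hg S hS hSb => ?_⟩
  · have hk' : (1 : ℝ) ≤ k := by exact_mod_cast hk
    -- `2k/(2k-1) ≤ 2` amounts to `k ≥ 1`, with equality exactly for the heat operator.
    rw [min_eq_right]
    rw [div_le_iff₀ (by linarith)]
    linarith
  · exact ⟨_, isFundamentalSymbol_parabolicSymbol d k, fun σ hσ => hσ.eq_parabolicSymbol⟩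
  · rw [hσ.eq_parabolicSymbol]
    exact hpar k hk
  · rw [heatSymbol_eq]
    exact isFundamentalSymbol_parabolicSymbol d 1
  · rw [heatSymbol_eq]
    have h := hpar 1 le_rfl 2 (by norm_num) g hg S hS hSb
    simpa only [Real.rpow_two] using h
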